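/- Let $D\ge 1$ and $\ell\ge 2$ be integers. For $n\ge 0$ let $\mathcal F_n$ be the family of the $\ell$-adic cubes $\prod_{i=1}^D[k_i\ell^{-n},(k_i+1)\ell^{-n})$, $0\le k_i<\ell^n$, of $[0,1)^D$. Suppose that for every $n$ the cubes of $\mathcal F_n$ are coded bijectively as $I_{\varepsilon_1\cdots\varepsilon_n}$ by the words $\varepsilon_1\cdots\varepsilon_n$ with letters in $\{0,\dots,\ell^D-1\}$, in such a way that $I_{\varepsilon_1\cdots\varepsilon_{n+1}}\subset I_{\varepsilon_1\cdots\varepsilon_n}$; for cubes $I,J\in\bigcup_n\mathcal F_n$ let $IJ$ be the cube whose word is the concatenation of those of $I$ and $J$. Let $m$ be a quasi-Bernoulli measure on $[0,1)^D$, that is, a Borel probability measure for which there is a constant $C\ge 1$ with $$\frac1C\,m(I)\,m(J)\le m(IJ)\le C\,m(I)\,m(J)\qquad\text{for all } I,J\in\bigcup_n\mathcal F_n .$$ Let $$\tau(q)=\limsup_{n\to\infty}\frac1{n\log\ell}\log\Bigl(\sum_{I\in\mathcal F_n,\ m(I)>0}m(I)^q\Bigr)$$ be its $L^q$-spectrum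 and $d=-\tau'(1)$. Suppose that there is a real $\sigma>0$ such that $$\tau(1-q)=qd+\frac{\sigma^2}2q^2+o(q^2)\qquad (q\to0).$$ For $a\in\mathbb R$ let $\psi_a(t)=t^d\,\ell^{\,a\sqrt{\log_\ell(1/t)}}$ for small $t>0$ and $\psi_a(0)=0$. Let $\mathcal H^{\psi}$ be the Hausdorff measure on $\mathbb R^D$ with gauge $\psi$, and let $\widehat{\mathcal P}^{\psi}$ be the packing measure with gauge $\psi$, namely $\widehat{\mathcal P}^{\psi}(E)=\inf\{\sum_i\mathcal P^\psi(E_i) : E\subset\bigcup_{i\in\mathbb N} E_i\}$, where $\mathcal P^\psi(E)$ is the limit as $\delta\to0^+$ of the supremum of $\sum_j\psi(2r_j)$ over the countable families of pairwise disjoint closed balls $B(x_j,r_j)$ with $x_j\in E$ and $0<r_j\le\delta$. Then $$m\perp\mathcal H^{\psi_a}\ \text{ for every } a>0,\qquad\text{and}\qquad m\ll\widehat{\mathcal P}^{\psi_a}\ \text{ for every } a<0 .$$ -/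

import Mathlib

open MeasureTheory Filter Topology
open scoped ENNReal Asymptotics

noncomputable section

namespace QuasiBernoulli

/-! ### Generalized Hausdorff and packing measures -/

section GaugeMeasures

variable {X : Type*} [MetricSpace X]

/-- The Hausdorff measure `H^ψ` with gauge function `ψ`: the limit as `δ → 0` of the infimum of
`∑ ψ (diam Uᵢ)` over the countable covers by sets of diameter at most `δ`. -/
def hausdorffGauge [MeasurableSpace X] [BorelSpace X] (ψ : ℝ → ℝ) : Measure X :=
  Measure.mkMetric fun t => ENNReal.ofReal (ψ t.toReal)

/-- A `δ`-packing of `E`: a countable family of pairwise disjoint closed balls, given by their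
centres and radii, with centres in `E` and radii in `(0, δ]`. -/
structure IsPacking (δ : ℝ) (E : Set X) (p : Set (X × ℝ)) : Prop where
  countable : p.Countable
  center_mem : ∀ b ∈ p, b.1 ∈ E
  radius_pos : ∀ b ∈ p, 0 < b.2
  radius_le : ∀ b ∈ p, b.2 ≤ δ
  disjoint : p.PairwiseDisjoint fun b => Metric.closedBall b.1 b.2

/-- The supremum of `∑ ψ (2 rᵢ)` over the `δ`-packings of `E`. -/
def packingAt (ψ : ℝ → ℝ) (δ : ℝ) (E : Set X) : ℝ≥0∞ :=
  ⨆ (p : Set (X × ℝ)) (_ : IsPacking δ E p), ∑' b : p, ENNReal.ofReal (ψ (2 * b.1.2))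

/-- The packing pre-measure `P^ψ`, the limit of `packingAt ψ δ` as `δ` decreases to `0`. -/
def packingPre (ψ : ℝ → ℝ) (E : Set X) : ℝ≥0∞ :=
  ⨅ (δ : ℝ) (_ : 0 < δ), packingAt ψ δ E

theorem packingAt_empty (ψ : ℝ → ℝ) (δ : ℝ) : packingAt ψ δ (∅ : Set X) = 0 := by
  simp only [packingAt, ENNReal.iSup_eq_zero]
  intro p hp
  have : p = ∅ := Set.eq_empty_of_forall_notMem fun b hb => hp.center_mem b hb
  subst this
  simp

theorem packingPre_empty (ψ : ℝ → ℝ) : packingPre ψ (∅ : Set X) = 0 :=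
  le_antisymm ((iInf₂_le 1 one_pos).trans (packingAt_empty ψ 1).le) bot_le

theorem packingAt_mono (ψ : ℝ → ℝ) {δ δ' : ℝ} (hδ : δ ≤ δ') {E F : Set X} (h : E ⊆ F) :
    packingAt ψ δ E ≤ packingAt ψ δ' F :=
  iSup_mono fun p => iSup_mono' fun hp =>
    ⟨⟨hp.countable, fun b hb => h (hp.center_mem b hb), hp.radius_pos,
      fun b hb => (hp.radius_le b hb).trans hδ, hp.disjoint⟩, le_rfl⟩

theorem packingPre_mono (ψ : ℝ → ℝ) {E F : Set X} (h : E ⊆ F) :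
    packingPre ψ E ≤ packingPre ψ F :=
  iInf₂_mono fun _ _ => packingAt_mono ψ le_rfl h

theorem packingAt_add_le (ψ : ℝ → ℝ) {δ : ℝ} {E F : Set X}
    (h : ∀ x ∈ E, ∀ y ∈ F, 2 * δ < dist x y) :
    packingAt ψ δ E + packingAt ψ δ F ≤ packingAt ψ δ (E ∪ F) := by
  have hdisj : ∀ b c : X × ℝ, b.1 ∈ E → c.1 ∈ F → b.2 ≤ δ → c.2 ≤ δ →
      Disjoint (Metric.closedBall b.1 b.2) (Metric.closedBall c.1 c.2) := by
    intro b c hb hc hbδ hcδ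
    exact Metric.closedBall_disjoint_closedBall (by linarith [h _ hb _ hc])
  unfold packingAt
  refine ENNReal.biSup_add_biSup_le' (p := fun p => IsPacking δ E p)
    (q := fun p => IsPacking δ F p) ⟨∅, by constructor <;> simp⟩ ⟨∅, by constructor <;> simp⟩ ?_
  intro p hp q hq
  have hpq : Disjoint p q := by
    rw [Set.disjoint_left]
    intro b hb hb'
    have := h _ (hp.center_mem b hb) _ (hq.center_mem b hb')
    rw [dist_self] at this
    linarith [hp.radius_pos b hb, hp.radius_le b hb]
  rw [← ENNReal.summable.tsum_union_disjoint (f := fun b : X × ℝ => ENNReal.ofReal (ψ (2 * b.2)))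
    hpq ENNReal.summable]
  refine le_iSup₂_of_le (p ∪ q) ⟨hp.countable.union hq.countable, ?_, ?_, ?_, ?_⟩ le_rfl
  · rintro b (hb | hb)
    · exact Or.inl (hp.center_mem b hb)
    · exact Or.inr (hq.center_mem b hb)
  · rintro b (hb | hb)
    · exact hp.radius_pos b hb
    · exact hq.radius_pos b hb
  · rintro b (hb | hb)
    · exact hp.radius_le b hb
    · exact hq.radius_le b hb
  · rintro b (hb | hb) c (hc | hc) hbc
    · exact hp.disjoint hb hc hbc
    · exact hdisj b c (hp.center_mem b hb) (hq.center_mem c hc) (hp.radius_le b hb)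
        (hq.radius_le c hc)
    · exact (hdisj c b (hp.center_mem c hc) (hq.center_mem b hb) (hp.radius_le c hc)
        (hq.radius_le b hb)).symm
    · exact hq.disjoint hb hc hbc

theorem packingPre_add_le (ψ : ℝ → ℝ) {E F : Set X} (h : Metric.AreSeparated E F) :
    packingPre ψ E + packingPre ψ F ≤ packingPre ψ (E ∪ F) := by
  obtain ⟨r, hr0, hr⟩ := h
  obtain ⟨s, hs0, hsr⟩ : ∃ s : ℝ, 0 < s ∧ ENNReal.ofReal s ≤ r := by
    rcases eq_or_ne r ⊤ with rfl | hr'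
    · exact ⟨1, one_pos, le_top⟩
    · exact ⟨r.toReal, ENNReal.toReal_pos hr0 hr', ENNReal.ofReal_toReal_le⟩
  refine le_iInf₂ fun δ hδ => ?_
  have hpos : 0 < min δ (s / 3) := lt_min hδ (by positivity)
  refine le_trans (add_le_add (iInf₂_le _ hpos) (iInf₂_le _ hpos)) ?_
  refine (packingAt_add_le ψ fun x hx y hy => ?_).trans
    (packingAt_mono ψ (min_le_left _ _) subset_rfl)
  have h1 : s ≤ dist x y := by
    have := hsr.trans (hr x hx y hy)
    rwa [edist_dist, ENNReal.ofReal_le_ofReal_iff dist_nonneg] at this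
  linarith [min_le_right δ (s / 3)]

/-- The packing measure as an outer measure: the infimum of `∑ P^ψ (Eᵢ)` over the countable
covers of a set by arbitrary sets `Eᵢ`. -/
def packingOuter (X : Type*) [MetricSpace X] (ψ : ℝ → ℝ) : OuterMeasure X :=
  OuterMeasure.ofFunction (packingPre ψ) (packingPre_empty ψ)

theorem packingOuter_isMetric (ψ : ℝ → ℝ) : (packingOuter X ψ).IsMetric := by
  intro s t hst
  refine le_antisymm (measure_union_le s t) ?_
  conv_rhs => rw [packingOuter, OuterMeasure.ofFunction_apply]
  refine le_iInf₂ fun U hU => ?_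
  have hs : packingOuter X ψ s ≤ ∑' i, packingPre ψ (U i ∩ s) := by
    rw [packingOuter, OuterMeasure.ofFunction_apply]
    refine iInf₂_le_of_le (fun i => U i ∩ s) ?_ le_rfl
    rw [← Set.iUnion_inter]
    exact Set.subset_inter (Set.subset_union_left.trans hU) subset_rfl
  have ht : packingOuter X ψ t ≤ ∑' i, packingPre ψ (U i ∩ t) := by
    rw [packingOuter, OuterMeasure.ofFunction_apply]
    refine iInf₂_le_of_le (fun i => U i ∩ t) ?_ le_rfl
    rw [← Set.iUnion_inter]
    exact Set.subset_inter (Set.subset_union_right.trans hU) subset_rfl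
  refine (add_le_add hs ht).trans ?_
  rw [← ENNReal.tsum_add]
  refine ENNReal.tsum_le_tsum fun i => ?_
  refine (packingPre_add_le ψ
    (hst.mono Set.inter_subset_right Set.inter_subset_right)).trans (packingPre_mono ψ ?_)
  exact Set.union_subset Set.inter_subset_left Set.inter_subset_left

/-- The packing measure with gauge function `ψ`, as a Borel measure. -/
def packingGauge [MeasurableSpace X] [BorelSpace X] (ψ : ℝ → ℝ) : Measure X :=
  (packingOuter X ψ).toMeasure <| by
    rw [BorelSpace.measurable_eq (α := X)]
    exact (packingOuter_isMetric ψ).borel_le_caratheodory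

end GaugeMeasures

/-! ### Quasi-Bernoulli measures on the unit cube -/

/-- The half-open `ℓ`-adic cube `∏ᵢ [kᵢ / ℓ ^ n, (kᵢ + 1) / ℓ ^ n)`. -/
def adicCube (D ℓ n : ℕ) (k : Fin D → Fin (ℓ ^ n)) : Set (EuclideanSpace ℝ (Fin D)) :=
  {x | ∀ i, x i ∈ Set.Ico (((k i : ℕ) : ℝ) / (ℓ : ℝ) ^ n) ((((k i : ℕ) : ℝ) + 1) / (ℓ : ℝ) ^ n)}

/-- The family `F_n` of the `ℓ`-adic cubes of the `n`-th generation of `[0,1)^D`. -/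
def adicCubes (D ℓ n : ℕ) : Set (Set (EuclideanSpace ℝ (Fin D))) :=
  Set.range (adicCube D ℓ n)

/-- A coding of the `ℓ`-adic cubes by words in `ℓ ^ D` letters: for each `n` the words of length
`n` correspond bijectively to the cubes of generation `n`, and appending a letter passes to a
smaller cube. -/
structure IsCoding (D ℓ : ℕ) (I : List (Fin (ℓ ^ D)) → Set (EuclideanSpace ℝ (Fin D))) :
    Prop where
  bijOn : ∀ n : ℕ, Set.BijOn I {w | w.length = n} (adicCubes D ℓ n)
  nested : ∀ (w : List (Fin (ℓ ^ D))) (e : Fin (ℓ ^ D)), I (w ++ [e]) ⊆ I w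

/-- `m` is a quasi-Bernoulli probability measure on `[0,1)^D` for the coding `I`. -/
structure IsQuasiBernoulli {D ℓ : ℕ} (I : List (Fin (ℓ ^ D)) → Set (EuclideanSpace ℝ (Fin D)))
    (m : Measure (EuclideanSpace ℝ (Fin D))) : Prop where
  isProbabilityMeasure : IsProbabilityMeasure m
  measure_unitCube : m {x | ∀ i, x i ∈ Set.Ico (0 : ℝ) 1} = 1
  quasi : ∃ C : ℝ, 1 ≤ C ∧ ∀ u v : List (Fin (ℓ ^ D)),
    1 / C * (m.real (I u) * m.real (I v)) ≤ m.real (I (u ++ v)) ∧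
      m.real (I (u ++ v)) ≤ C * (m.real (I u) * m.real (I v))

/-- `τ_n(q) = (1 / (n log ℓ)) log ∑ m(I) ^ q`, the sum being over the cubes `I` of generation `n`
with positive measure. -/
def tauAt {D : ℕ} (ℓ : ℕ) (m : Measure (EuclideanSpace ℝ (Fin D))) (n : ℕ) (q : ℝ) : ℝ :=
  1 / (n * Real.log ℓ) *
    Real.log (∑ k : Fin D → Fin (ℓ ^ n) with 0 < m.real (adicCube D ℓ n k),
      m.real (adicCube D ℓ n k) ^ q)

/-- The `L^q`-spectrum `τ` of `m`. -/
def tau {D : ℕ} (ℓ : ℕ) (m : Measure (EuclideanSpace ℝ (Fin D))) (q : ℝ) : ℝ :=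
  limsup (fun n => tauAt ℓ m n q) atTop

/-- The gauge `ψ_a(t) = t ^ d ℓ ^ (a √(log_ℓ (1 / t)))`, of interest for small `t > 0`. -/
def psi (ℓ : ℕ) (d a t : ℝ) : ℝ :=
  t ^ d * (ℓ : ℝ) ^ (a * √(Real.logb ℓ (1 / t)))

end QuasiBernoulli

end

noncomputable section

namespace QuasiBernoulli

/-! ### Almost additive sequences -/

/-! Under `m`, the quantity `X_n = log m(I_n(x)) + n d log ℓ`, with `I_n(x)` the cube of generation
`n` around `x`, fluctuates on the scale `√n`. For `m`-almost every `x` it exceeds `A √n` for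
infinitely many `n`, and it is below `-A √n` for infinitely many `n`, whatever `A` is. Both
conclusions follow, since `ψ_a` differs from `t ^ d` by a factor `exp (a log ℓ √n)` at scale `ℓ ^
(-n)`.

No central limit theorem is needed. The quasi-Bernoulli property makes the logarithm of the
partition sum almost additive, hence equal to `n τ(q) log ℓ` up to an error bounded in `n`. At `1 -
θ/√n` the expansion of `τ` then bounds the exponential moments of `X_n / √n` above and below by
Gaussian ones, up to constants. The Paley–Zygmund inequality turns this into a deviation of size `A
√n`, of either sign, on a proportion of mass that does not depend on `n`
(`exists_le_sum_fluctuation`). Quasi-multiplicativity reproduces this proportion inside every cube,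
and a density argument upgrades it to full measure (`measure_compl_fluctuation_eq_zero`).

Heavy cubes satisfy `ψ_a(diam I) ≤ const · exp (-√n) m(I)`, so their limsup set is `H^ψ`-null. Light
cubes yield light balls, at the cost of a factor `n ^ 2` given by Borel–Cantelli; the lower
`ψ_a`-density of `m` then vanishes almost everywhere, and Vitali's covering theorem concludes. -/

theorem exists_tendsto_div_of_almost_additive {a : ℕ → ℝ} {κ : ℝ}
    (h : ∀ n p, |a (n + p) - (a n + a p)| ≤ κ) :
    ∃ L, Tendsto (fun n => a n / n) atTop (𝓝 L) ∧ ∀ n : ℕ, |a n - n * L| ≤ κ := by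
  have h0 : |a 0| ≤ κ := by simpa using h 0 0
  have hκ : 0 ≤ κ := (abs_nonneg _).trans h0
  -- A crude linear bound, which supplies the boundedness that Fekete's lemma requires.
  have hlin : ∀ n : ℕ, |a (n + 1) - (n + 1) * a 1| ≤ n * κ := by
    intro n
    induction n with
    | zero => simp
    | succ n ih =>
      have h1 := abs_le.1 (h (n + 1) 1)
      have h2 := abs_le.1 ih
      push_cast
      rw [abs_le]
      constructor <;> linarith
  -- Fekete's lemma applied to both `a + κ` and `-a + κ` bounds `a n - n L` from each side, because
  -- the two limits are opposite.
  have hup : Subadditive fun n => a n + κ := fun n p => by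
    have := (abs_le.1 (h n p)).2
    linarith
  have hdown : Subadditive fun n => -a n + κ := fun n p => by
    have := (abs_le.1 (h n p)).1
    linarith
  have hbdd : ∀ n : ℕ, n ≠ 0 → |a n / n| ≤ |a 1| + κ := by
    intro n hn
    obtain ⟨k, rfl⟩ := Nat.exists_eq_succ_of_ne_zero hn
    have hpos : (0 : ℝ) < ((k + 1 : ℕ) : ℝ) := by positivity
    rw [abs_div, abs_of_pos hpos, div_le_iff₀ hpos]
    have h1 : |a (k + 1)| ≤ |((k : ℝ) + 1) * a 1| + k * κ := by
      have := abs_add_le (((k : ℝ) + 1) * a 1) (a (k + 1) - (k + 1) * a 1)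
      rw [add_sub_cancel] at this
      linarith [hlin k]
    rw [abs_mul, abs_of_nonneg (by positivity : (0 : ℝ) ≤ (k : ℝ) + 1)] at h1
    push_cast
    nlinarith
  have hbelow : ∀ b : ℕ → ℝ, (∀ n : ℕ, n ≠ 0 → |b n / n| ≤ |a 1| + κ) →
      BddBelow (Set.range fun n : ℕ => (b n + κ) / n) := by
    rintro b hb
    refine ⟨-(|a 1| + κ), ?_⟩
    rintro _ ⟨n, rfl⟩
    rcases eq_or_ne n 0 with rfl | hn
    · simp only [CharP.cast_eq_zero, div_zero]
      linarith [abs_nonneg (a 1)]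
    · have h1 := (abs_le.1 (hb n hn)).1
      have h2 : (0 : ℝ) ≤ κ / n := by positivity
      simp only [add_div]
      linarith
  have hbu := hbelow a hbdd
  have hbd := hbelow (fun n => -a n) fun n hn => by simpa [neg_div] using hbdd n hn
  have hκn : Tendsto (fun n : ℕ => κ / n) atTop (𝓝 0) := tendsto_const_div_atTop_nhds_zero_nat κ
  have ht : Tendsto (fun n => a n / n) atTop (𝓝 hup.lim) := by
    have := (hup.tendsto_lim hbu).sub hκn
    simpa [add_div] using this
  have ht' : Tendsto (fun n => a n / n) atTop (𝓝 (-hdown.lim)) := by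
    have := ((hdown.tendsto_lim hbd).sub hκn).neg
    simpa [add_div, neg_div] using this
  have hlim := tendsto_nhds_unique ht ht'
  refine ⟨hup.lim, ht, fun n => ?_⟩
  rcases eq_or_ne n 0 with rfl | hn
  · simpa using h0
  · have hpos : (0 : ℝ) < n := by positivity
    have h1 := hup.lim_le_div hbu hn
    have h2 := hdown.lim_le_div hbd hn
    rw [le_div_iff₀ hpos] at h1 h2
    rw [abs_le]
    constructor
    · linarith
    · have h3 : hdown.lim = -hup.lim := by linarith
      rw [h3] at h2
      linarith

/-! ### Quasi-multiplicative weights on words -/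

section Words

variable {α : Type*} [Finite α]

/-- The words of length `n`. -/
def words (α : Type*) [Finite α] (n : ℕ) : Finset (List α) :=
  (List.finite_length_eq α n).toFinset

@[simp] theorem mem_words {n : ℕ} {w : List α} : w ∈ words α n ↔ w.length = n := by
  simp [words]

theorem sum_words_add (f : List α → ℝ) (n p : ℕ) :
    ∑ w ∈ words α (n + p), f w = ∑ u ∈ words α n, ∑ v ∈ words α p, f (u ++ v) := by
  rw [← Finset.sum_product']
  refine (Finset.sum_bij' (fun x _ => x.1 ++ x.2) (fun w _ => (w.take n, w.drop n))
    ?_ ?_ ?_ ?_ ?_).symm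
  · rintro ⟨u, v⟩ h
    simp_all
  · intro w h
    simp_all
  · rintro ⟨u, v⟩ h
    simp only [Finset.mem_product, mem_words] at h
    simp [← h.1]
  · intro w h
    simp
  · rintro ⟨u, v⟩ h
    rfl

/-- A weight on words with total mass one in each length which is multiplicative up to the
factor `C`. -/
structure IsQuasiMultiplicative (μ : List α → ℝ) (C : ℝ) : Prop where
  one_le : 1 ≤ C
  nonneg : ∀ w, 0 ≤ μ w
  sum_eq_one : ∀ n, ∑ w ∈ words α n, μ w = 1
  lower : ∀ u v, 1 / C * (μ u * μ v) ≤ μ (u ++ v)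
  upper : ∀ u v, μ (u ++ v) ≤ C * (μ u * μ v)

/-- The sum of the `q`-th powers of the positive weights of the words of length `n`. -/
def partitionSum (μ : List α → ℝ) (n : ℕ) (q : ℝ) : ℝ :=
  ∑ w ∈ words α n with 0 < μ w, μ w ^ q

namespace IsQuasiMultiplicative

variable {μ : List α → ℝ} {C : ℝ} (h : IsQuasiMultiplicative μ C)

include h

/-- Restricting to positive weights is thus compatible with concatenation, so the partition sums
factor up to constants. -/
theorem append_pos_iff (u v : List α) : 0 < μ (u ++ v) ↔ 0 < μ u ∧ 0 < μ v := by
  have hC : 0 < C := one_pos.trans_le h.one_le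
  constructor
  · intro huv
    have h1 : 0 < μ u * μ v := pos_of_mul_pos_right (huv.trans_le (h.upper u v)) hC.le
    exact ⟨pos_of_mul_pos_left h1 (h.nonneg v), pos_of_mul_pos_right h1 (h.nonneg u)⟩
  · rintro ⟨hu, hv⟩
    exact lt_of_lt_of_le (by positivity) (h.lower u v)

theorem abs_log_append_sub_le {u v : List α} (hu : 0 < μ u) (hv : 0 < μ v) :
    |Real.log (μ (u ++ v)) - (Real.log (μ u) + Real.log (μ v))| ≤ Real.log C := by
  have hC : 0 < C := one_pos.trans_le h.one_le
  have huv := (h.append_pos_iff u v).2 ⟨hu, hv⟩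
  have h1 := Real.log_le_log huv (h.upper u v)
  have h2 := Real.log_le_log (by positivity) (h.lower u v)
  rw [Real.log_mul (by positivity) (by positivity), Real.log_mul hu.ne' hv.ne'] at h1 h2
  rw [one_div, Real.log_inv] at h2
  rw [abs_le]
  constructor <;> linarith

theorem partitionSum_pos (n : ℕ) (q : ℝ) : 0 < partitionSum μ n q := by
  refine Finset.sum_pos (fun w hw => Real.rpow_pos_of_pos (Finset.mem_filter.1 hw).2 q) ?_
  by_contra hne
  rw [Finset.not_nonempty_iff_eq_empty, Finset.filter_eq_empty_iff] at hne
  have h1 := h.sum_eq_one n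
  rw [Finset.sum_eq_zero fun w hw => le_antisymm (not_lt.1 (hne hw)) (h.nonneg w)] at h1
  exact zero_ne_one h1

theorem partitionSum_add (n p : ℕ) (q : ℝ) :
    partitionSum μ (n + p) q =
      ∑ u ∈ words α n with 0 < μ u, ∑ v ∈ words α p with 0 < μ v, μ (u ++ v) ^ q := by
  rw [partitionSum, Finset.sum_filter, sum_words_add, Finset.sum_filter]
  refine Finset.sum_congr rfl fun u _ => ?_
  rw [Finset.sum_filter]
  by_cases hu : 0 < μ u <;> simp [h.append_pos_iff, hu]

/-- Each term is multiplicative up to `C ^ |q|`; the absolute value is there because a negative `q`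
exchanges the two bounds. -/
theorem abs_log_partitionSum_add_sub_le (n p : ℕ) (q : ℝ) :
    |Real.log (partitionSum μ (n + p) q) -
      (Real.log (partitionSum μ n q) + Real.log (partitionSum μ p q))| ≤ |q| * Real.log C := by
  have hpos := fun k => h.partitionSum_pos k q
  have hpow : ∀ u v, 0 < μ u → 0 < μ v →
      Real.exp (-(|q| * Real.log C)) * (μ u ^ q * μ v ^ q) ≤ μ (u ++ v) ^ q ∧
      μ (u ++ v) ^ q ≤ Real.exp (|q| * Real.log C) * (μ u ^ q * μ v ^ q) := by
    intro u v hu hv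
    have huv := (h.append_pos_iff u v).2 ⟨hu, hv⟩
    have h1 := mul_le_mul_of_nonneg_left (h.abs_log_append_sub_le hu hv) (abs_nonneg q)
    rw [← abs_mul, abs_le] at h1
    simp only [Real.rpow_def_of_pos hu, Real.rpow_def_of_pos hv, Real.rpow_def_of_pos huv,
      ← Real.exp_add, Real.exp_le_exp]
    constructor <;> linarith
  have hprod : partitionSum μ n q * partitionSum μ p q =
      ∑ u ∈ words α n with 0 < μ u, ∑ v ∈ words α p with 0 < μ v, μ u ^ q * μ v ^ q :=
    Finset.sum_mul_sum _ _ _ _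
  have hle : partitionSum μ (n + p) q ≤
      Real.exp (|q| * Real.log C) * (partitionSum μ n q * partitionSum μ p q) := by
    rw [h.partitionSum_add, hprod, Finset.mul_sum]
    refine Finset.sum_le_sum fun u hu => ?_
    rw [Finset.mul_sum]
    exact Finset.sum_le_sum fun v hv =>
      (hpow u v (Finset.mem_filter.1 hu).2 (Finset.mem_filter.1 hv).2).2
  have hge : Real.exp (-(|q| * Real.log C)) * (partitionSum μ n q * partitionSum μ p q) ≤
      partitionSum μ (n + p) q := by
    rw [h.partitionSum_add, hprod, Finset.mul_sum]
    refine Finset.sum_le_sum fun u hu => ?_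
    rw [Finset.mul_sum]
    exact Finset.sum_le_sum fun v hv =>
      (hpow u v (Finset.mem_filter.1 hu).2 (Finset.mem_filter.1 hv).2).1
  have hn := hpos n
  have hp := hpos p
  have h1 := Real.log_le_log (hpos (n + p)) hle
  have h2 := Real.log_le_log (by positivity) hge
  rw [Real.log_mul (by positivity) (by positivity), Real.log_mul hn.ne' hp.ne',
    Real.log_exp] at h1 h2
  rw [abs_le]
  constructor <;> linarith

end IsQuasiMultiplicative

end Words

/-! ### Fluctuations of the weights -/

/-- A finite Paley–Zygmund inequality. -/
theorem sq_sum_le_four_mul_sum_filter {ι : Type*} (s : Finset ι) {μ f : ι → ℝ}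
    (hμ : ∀ i ∈ s, 0 ≤ μ i) (hsum : ∑ i ∈ s, μ i ≤ 1) (hf : ∀ i ∈ s, 0 ≤ f i) :
    (∑ i ∈ s, μ i * f i) ^ 2 ≤
      4 * ((∑ i ∈ s with (∑ i ∈ s, μ i * f i) / 2 ≤ f i, μ i) * ∑ i ∈ s, μ i * f i ^ 2) := by
  set M := ∑ i ∈ s, μ i * f i with hM
  have hM0 : 0 ≤ M := Finset.sum_nonneg fun i hi => mul_nonneg (hμ i hi) (hf i hi)
  have hsplit := Finset.sum_filter_add_sum_filter_not s (fun i => M / 2 ≤ f i)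
    (fun i => μ i * f i)
  -- Small values of `f` carry at most half of the mean, so the large ones carry the other half;
  -- Cauchy–Schwarz then bounds their mass from below.
  have hsmall : ∑ i ∈ s with ¬M / 2 ≤ f i, μ i * f i ≤ M / 2 := by
    calc ∑ i ∈ s with ¬M / 2 ≤ f i, μ i * f i
        ≤ ∑ i ∈ s with ¬M / 2 ≤ f i, μ i * (M / 2) := by
          refine Finset.sum_le_sum fun i hi => ?_
          rw [Finset.mem_filter] at hi
          exact mul_le_mul_of_nonneg_left (not_le.1 hi.2).le (hμ i hi.1)
      _ ≤ ∑ i ∈ s, μ i * (M / 2) :=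
          Finset.sum_le_sum_of_subset_of_nonneg (Finset.filter_subset _ _)
            fun i hi _ => mul_nonneg (hμ i hi) (by positivity)
      _ ≤ M / 2 := by
          rw [← Finset.sum_mul]
          exact mul_le_of_le_one_left (by positivity) hsum
  have hcs : (∑ i ∈ s with M / 2 ≤ f i, μ i * f i) ^ 2 ≤
      (∑ i ∈ s with M / 2 ≤ f i, μ i) * ∑ i ∈ s with M / 2 ≤ f i, μ i * f i ^ 2 := by
    refine Finset.sum_sq_le_sum_mul_sum_of_sq_le_mul _ ?_ ?_ ?_
    · exact fun i hi => hμ i (Finset.mem_filter.1 hi).1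
    · exact fun i hi => mul_nonneg (hμ i (Finset.mem_filter.1 hi).1) (sq_nonneg _)
    · intro i _
      exact le_of_eq (by ring)
  have hmono : ∑ i ∈ s with M / 2 ≤ f i, μ i * f i ^ 2 ≤ ∑ i ∈ s, μ i * f i ^ 2 :=
    Finset.sum_le_sum_of_subset_of_nonneg (Finset.filter_subset _ _)
      fun i hi _ => mul_nonneg (hμ i hi) (sq_nonneg _)
  have hP : 0 ≤ ∑ i ∈ s with M / 2 ≤ f i, μ i :=
    Finset.sum_nonneg fun i hi => hμ i (Finset.mem_filter.1 hi).1
  have hlarge : M / 2 ≤ ∑ i ∈ s with M / 2 ≤ f i, μ i * f i := by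
    rw [← hM] at hsplit
    linarith
  have h1 := pow_le_pow_left₀ (by positivity) hlarge 2
  have h2 := mul_le_mul_of_nonneg_left hmono hP
  nlinarith

section Fluctuation

variable {α : Type*} [Finite α] {μ : List α → ℝ} {C : ℝ}

/-- With `q = θ/√n` the product `n q ^ 2` is the constant `θ ^ 2`: the quadratic term becomes a
Gaussian exponent and the `o(q ^ 2)` error stays bounded. The constant `2 log C` comes from `|1 - q|
≤ 2`. -/
theorem eventually_abs_log_partitionSum_sub_le {g : ℝ → ℝ} {d v : ℝ} (hC : 1 ≤ C)
    (hg : ∀ n q, |Real.log (partitionSum μ n (1 - q)) - n * g q| ≤ |1 - q| * Real.log C)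
    (hexp : (fun q => g q - (q * d + v / 2 * q ^ 2)) =o[𝓝 0] fun q : ℝ => q ^ 2) (θ : ℝ) :
    ∀ᶠ n : ℕ in atTop, |Real.log (partitionSum μ n (1 - θ / √n)) - √n * θ * d - v * θ ^ 2 / 2|
      ≤ 2 * Real.log C + 1 := by
  have hq : Tendsto (fun n : ℕ => θ / √(n : ℝ)) atTop (𝓝 0) :=
    tendsto_const_nhds.div_atTop (Real.tendsto_sqrt_atTop.comp tendsto_natCast_atTop_atTop)
  have hε : (0 : ℝ) < 1 / (θ ^ 2 + 1) := by positivity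
  filter_upwards [hq.eventually (hexp.def hε), hq.eventually (Metric.ball_mem_nhds 0 one_pos),
    eventually_gt_atTop 0] with n h1 h2 hn
  have hpos : (0 : ℝ) < n := by positivity
  have hs : (0 : ℝ) < √n := Real.sqrt_pos.2 hpos
  have hss : √(n : ℝ) ^ 2 = n := Real.sq_sqrt hpos.le
  set q := θ / √(n : ℝ) with hqdef
  have hnq : n * q = √n * θ := by
    rw [hqdef, mul_div_assoc', div_eq_iff hs.ne']
    linear_combination -θ * hss
  have hnq2 : n * q ^ 2 = θ ^ 2 := by
    rw [hqdef, div_pow, hss]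
    field_simp
  simp only [Real.norm_eq_abs, abs_pow, sq_abs] at h1
  rw [dist_zero_right, Real.norm_eq_abs] at h2
  have h3 : |n * g q - √n * θ * d - v * θ ^ 2 / 2| ≤ 1 := by
    have h4 : n * g q - √n * θ * d - v * θ ^ 2 / 2 = n * (g q - (q * d + v / 2 * q ^ 2)) := by
      rw [← hnq, ← hnq2]
      ring
    rw [h4, abs_mul, abs_of_pos hpos]
    calc n * |g q - (q * d + v / 2 * q ^ 2)| ≤ n * (1 / (θ ^ 2 + 1) * q ^ 2) :=
          mul_le_mul_of_nonneg_left h1 hpos.le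
      _ = θ ^ 2 / (θ ^ 2 + 1) := by rw [← hnq2]; ring
      _ ≤ 1 := by
          rw [div_le_one (by positivity)]
          linarith
  have hlog : 0 ≤ Real.log C := Real.log_nonneg hC
  have h5 : |1 - q| ≤ 2 := by
    rw [abs_lt] at h2
    rw [abs_le]
    constructor <;> linarith
  have h6 := (hg n q).trans (mul_le_mul_of_nonneg_right h5 hlog)
  rw [abs_le] at h3 h6 ⊢
  constructor <;> linarith

/-- A positive proportion of the words of length `n` have a weight that deviates from
`exp (-n d)` by a factor `exp (A √n)` in the direction given by the sign `s`. -/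
theorem IsQuasiMultiplicative.exists_le_sum_fluctuation (h : IsQuasiMultiplicative μ C)
    {g : ℝ → ℝ} {d v : ℝ} (hv : 0 < v)
    (hg : ∀ n q, |Real.log (partitionSum μ n (1 - q)) - n * g q| ≤ |1 - q| * Real.log C)
    (hexp : (fun q => g q - (q * d + v / 2 * q ^ 2)) =o[𝓝 0] fun q : ℝ => q ^ 2)
    {s : ℝ} (hs : s ^ 2 = 1) {A : ℝ} (hA : 0 ≤ A) :
    ∃ c : ℝ, 0 < c ∧ ∀ᶠ n : ℕ in atTop,
      c ≤ ∑ w ∈ words α n with 0 < μ w ∧ A * √n ≤ s * (Real.log (μ w) + n * d), μ w := by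
  set B := 2 * Real.log C + 1 with hB
  have hB0 : 0 ≤ B := by
    have := Real.log_nonneg h.one_le
    positivity
  -- Large enough that the Gaussian exponent `v θ ^ 2 / 2` beats the target `A θ` and the error `B +
  -- 1`.
  set θ := 2 * (A + B + 1) / v + 1 with hθ
  have hθ1 : 1 ≤ θ := by
    have : 0 ≤ 2 * (A + B + 1) / v := by positivity
    linarith
  have hθ0 : 0 < θ := one_pos.trans_le hθ1
  have hθv : A * θ + B + 1 ≤ v * θ ^ 2 / 2 := by
    have h1 : v * θ = 2 * (A + B + 1) + v := by
      rw [hθ]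
      field_simp
    nlinarith
  -- This is `M₁ ^ 2 / (4 M₂)` with the bounds `M₁ ≥ exp (v θ ^ 2 / 2 - B)` and `M₂ ≤ exp (2 v θ ^ 2
  -- + B)` on the two moments.
  refine ⟨Real.exp (-(v * θ ^ 2) - 3 * B) / 4, by positivity, ?_⟩
  have hev := fun t => eventually_abs_log_partitionSum_sub_le (d := d) h.one_le hg hexp t
  filter_upwards [hev (-s * θ), hev (2 * (-s * θ)), eventually_gt_atTop 0] with n h1 h2 hn
  have hpos : (0 : ℝ) < n := by positivity
  have hsq : (0 : ℝ) < √n := Real.sqrt_pos.2 hpos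
  set f : List α → ℝ := fun w => Real.exp (θ / √n * (s * (Real.log (μ w) + n * d))) with hf
  -- Exponential moments of the normalised fluctuation are partition sums at `1 + t/√n`; `t = sθ`
  -- and `t = 2sθ` give the first two moments of `f`.
  have hmom : ∀ t : ℝ, ∑ w ∈ words α n with 0 < μ w, μ w *
      Real.exp (t / √n * (Real.log (μ w) + n * d)) =
        Real.exp (Real.log (partitionSum μ n (1 - -t / √n)) - √n * -t * d) := by
    intro t
    rw [Real.exp_sub, Real.exp_log (h.partitionSum_pos _ _), partitionSum, Finset.sum_div]
    refine Finset.sum_congr rfl fun w hw => ?_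
    have hw0 := (Finset.mem_filter.1 hw).2
    rw [Real.rpow_def_of_pos hw0, ← Real.exp_sub]
    conv_lhs => rw [← Real.exp_log hw0]
    rw [Real.log_exp, ← Real.exp_add]
    congr 1
    have hdiv : (n : ℝ) / √n = √n := Real.div_sqrt
    linear_combination t * d * hdiv
  have hM1 : ∑ w ∈ words α n with 0 < μ w, μ w * f w =
      Real.exp (Real.log (partitionSum μ n (1 - -s * θ / √n)) - √n * (-s * θ) * d) := by
    have := hmom (s * θ)
    rw [← neg_mul] at this
    rw [← this]
    refine Finset.sum_congr rfl fun w _ => ?_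
    rw [hf]
    ring_nf
  have hM2 : ∑ w ∈ words α n with 0 < μ w, μ w * f w ^ 2 =
      Real.exp (Real.log (partitionSum μ n (1 - 2 * (-s * θ) / √n)) -
        √n * (2 * (-s * θ)) * d) := by
    have := hmom (2 * (s * θ))
    rw [show -(2 * (s * θ)) = 2 * (-s * θ) by ring] at this
    rw [← this]
    refine Finset.sum_congr rfl fun w _ => ?_
    rw [hf, sq, ← Real.exp_add]
    ring_nf
  have hpz := sq_sum_le_four_mul_sum_filter (s := {w ∈ words α n | 0 < μ w}) (μ := μ) (f := f)
    (fun w _ => h.nonneg w)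
    ((Finset.sum_le_sum_of_subset_of_nonneg (Finset.filter_subset _ _)
      fun w _ _ => h.nonneg w).trans (h.sum_eq_one n).le)
    (fun w _ => (Real.exp_pos _).le)
  rw [Finset.filter_filter] at hpz
  set M₁ := ∑ w ∈ words α n with 0 < μ w, μ w * f w with hM₁
  set M₂ := ∑ w ∈ words α n with 0 < μ w, μ w * f w ^ 2 with hM₂
  rw [abs_le] at h1 h2
  have hsθ : (-s * θ) ^ 2 = θ ^ 2 := by rw [mul_pow, neg_sq, hs, one_mul]
  rw [mul_pow, hsθ] at h2
  rw [hsθ] at h1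
  have hM1' : Real.exp (v * θ ^ 2 / 2 - B) ≤ M₁ := by
    rw [hM1, Real.exp_le_exp]
    linarith
  have hM2' : M₂ ≤ Real.exp (2 * (v * θ ^ 2) + B) := by
    rw [hM2, Real.exp_le_exp]
    linarith
  have hM20 : 0 < M₂ := by
    rw [hM2]
    positivity
  have hsub : ∑ w ∈ words α n with 0 < μ w ∧ M₁ / 2 ≤ f w, μ w ≤
      ∑ w ∈ words α n with 0 < μ w ∧ A * √n ≤ s * (Real.log (μ w) + n * d), μ w := by
    refine Finset.sum_le_sum_of_subset_of_nonneg ?_ fun w _ _ => h.nonneg w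
    intro w hw
    rw [Finset.mem_filter] at hw ⊢
    refine ⟨hw.1, hw.2.1, ?_⟩
    -- Replacing the factor `1/2` by the smaller `1/e` keeps everything exponential; this is the `1`
    -- in `B + 1`.
    have h3 : Real.exp (v * θ ^ 2 / 2 - B) / Real.exp 1 ≤ f w := by
      refine le_trans ?_ ((div_le_div_of_nonneg_right hM1' zero_le_two).trans hw.2.2)
      refine div_le_div_of_nonneg_left (Real.exp_pos _).le two_pos ?_
      linarith [Real.add_one_le_exp (1 : ℝ)]
    rw [← Real.exp_sub, hf, Real.exp_le_exp] at h3
    have h4 : θ * A ≤ θ * (s * (Real.log (μ w) + n * d) / √n) := by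
      calc θ * A ≤ θ / √n * (s * (Real.log (μ w) + n * d)) := by linarith
        _ = _ := by ring
    rwa [mul_le_mul_iff_right₀ hθ0, le_div_iff₀ hsq] at h4
  set P := ∑ w ∈ words α n with 0 < μ w ∧ M₁ / 2 ≤ f w, μ w with hP
  refine le_trans ?_ hsub
  have hP0 : 0 ≤ P := Finset.sum_nonneg fun w _ => h.nonneg w
  have h5 : Real.exp (v * θ ^ 2 / 2 - B) ^ 2 ≤ 4 * (P * Real.exp (2 * (v * θ ^ 2) + B)) :=
    (pow_le_pow_left₀ (Real.exp_pos _).le hM1' 2).trans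
      (hpz.trans (by gcongr))
  have h6 : Real.exp (v * θ ^ 2 / 2 - B) ^ 2 =
      Real.exp (-(v * θ ^ 2) - 3 * B) * Real.exp (2 * (v * θ ^ 2) + B) := by
    rw [sq, ← Real.exp_add, ← Real.exp_add]
    ring_nf
  rw [h6, ← mul_assoc (4 : ℝ)] at h5
  have h7 := le_of_mul_le_mul_right h5 (Real.exp_pos _)
  linarith

end Fluctuation

theorem sqrt_add_le_add_sqrt {x y : ℝ} (hx : 0 ≤ x) (hy : 0 ≤ y) : √(x + y) ≤ √x + √y := by
  rw [Real.sqrt_le_left (by positivity)]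
  nlinarith [Real.sq_sqrt hx, Real.sq_sqrt hy, mul_nonneg (Real.sqrt_nonneg x) (Real.sqrt_nonneg y)]

/-! ### The geometry of the adic cubes -/

/-- The half-open unit cube `[0,1)^D`. -/
def unitCube (D : ℕ) : Set (EuclideanSpace ℝ (Fin D)) :=
  {x | ∀ i, x i ∈ Set.Ico (0 : ℝ) 1}

section Cubes

variable {D ℓ n : ℕ}

theorem mem_adicCube_iff (hℓ : 0 < ℓ) {k : Fin D → Fin (ℓ ^ n)} {x : EuclideanSpace ℝ (Fin D)} :
    x ∈ adicCube D ℓ n k ↔ ∀ i, 0 ≤ x i ∧ ⌊x i * (ℓ : ℝ) ^ n⌋₊ = k i := by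
  have hpos : (0 : ℝ) < (ℓ : ℝ) ^ n := by positivity
  refine forall_congr' fun i => ?_
  rw [Set.mem_Ico, div_le_iff₀ hpos, lt_div_iff₀ hpos]
  constructor
  · rintro ⟨h1, h2⟩
    have h0 : 0 ≤ x i * (ℓ : ℝ) ^ n := (Nat.cast_nonneg _).trans h1
    exact ⟨nonneg_of_mul_nonneg_left h0 hpos, (Nat.floor_eq_iff h0).2 ⟨h1, h2⟩⟩
  · rintro ⟨h0, h1⟩
    exact (Nat.floor_eq_iff (by positivity)).1 h1

theorem disjoint_adicCube (hℓ : 0 < ℓ) {k k' : Fin D → Fin (ℓ ^ n)} (h : k ≠ k') :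
    Disjoint (adicCube D ℓ n k) (adicCube D ℓ n k') := by
  rw [Set.disjoint_left]
  intro x hx hx'
  rw [mem_adicCube_iff hℓ] at hx hx'
  exact h (funext fun i => Fin.ext ((hx i).2.symm.trans (hx' i).2))

theorem adicCube_nonempty (hℓ : 0 < ℓ) (k : Fin D → Fin (ℓ ^ n)) :
    (adicCube D ℓ n k).Nonempty := by
  have hpos : (0 : ℝ) < (ℓ : ℝ) ^ n := by positivity
  refine ⟨WithLp.toLp 2 fun i => ((k i : ℕ) : ℝ) / (ℓ : ℝ) ^ n, fun i => ⟨le_rfl, ?_⟩⟩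
  exact div_lt_div_of_pos_right (lt_add_one _) hpos

theorem adicCube_injective (hℓ : 0 < ℓ) : Function.Injective (adicCube D ℓ n) := by
  intro k k' h
  by_contra hne
  have h1 := disjoint_adicCube hℓ hne
  rw [h, disjoint_self] at h1
  exact (adicCube_nonempty hℓ k').ne_empty h1

theorem measurableSet_adicCube (k : Fin D → Fin (ℓ ^ n)) : MeasurableSet (adicCube D ℓ n k) := by
  rw [adicCube, Set.ofPred_forall]
  exact MeasurableSet.iInter fun i =>
    (measurable_pi_apply i |>.comp (WithLp.measurable_ofLp 2 _)) measurableSet_Ico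

theorem measurableSet_unitCube : MeasurableSet (unitCube D) := by
  rw [unitCube, Set.ofPred_forall]
  exact MeasurableSet.iInter fun i =>
    (measurable_pi_apply i |>.comp (WithLp.measurable_ofLp 2 _)) measurableSet_Ico

theorem iUnion_adicCube (hℓ : 0 < ℓ) : ⋃ k, adicCube D ℓ n k = unitCube D := by
  have hpos : (0 : ℝ) < (ℓ : ℝ) ^ n := by positivity
  ext x
  simp only [Set.mem_iUnion, unitCube, Set.mem_ofPred_eq]
  constructor
  · rintro ⟨k, hk⟩ i
    have h1 : (((k i : ℕ) : ℝ) + 1) ≤ (ℓ : ℝ) ^ n := by exact_mod_cast (k i).2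
    exact ⟨le_trans (by positivity) (hk i).1,
      (hk i).2.trans_le ((div_le_one hpos).2 h1)⟩
  · intro hx
    refine ⟨fun i => ⟨⌊x i * (ℓ : ℝ) ^ n⌋₊, ?_⟩,
      (mem_adicCube_iff hℓ).2 fun i => ⟨(hx i).1, rfl⟩⟩
    rw [Nat.floor_lt (mul_nonneg (hx i).1 hpos.le)]
    push_cast
    exact mul_lt_of_lt_one_left hpos (hx i).2

end Cubes

/-! ### Codings -/

theorem IsQuasiBernoulli.measure_unitCube_compl {D ℓ : ℕ}
    {I : List (Fin (ℓ ^ D)) → Set (EuclideanSpace ℝ (Fin D))}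
    {m : Measure (EuclideanSpace ℝ (Fin D))} (hm : IsQuasiBernoulli I m) :
    m (unitCube D)ᶜ = 0 := by
  have := hm.isProbabilityMeasure
  exact (prob_compl_eq_zero_iff measurableSet_unitCube).2 hm.measure_unitCube

namespace IsCoding

variable {D ℓ : ℕ} {I : List (Fin (ℓ ^ D)) → Set (EuclideanSpace ℝ (Fin D))}
  (hI : IsCoding D ℓ I)

include hI

theorem exists_eq_adicCube (w : List (Fin (ℓ ^ D))) : ∃ k, I w = adicCube D ℓ w.length k := by
  obtain ⟨k, hk⟩ := (hI.bijOn w.length).mapsTo rfl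
  exact ⟨k, hk.symm⟩

theorem exists_word_eq {n : ℕ} (k : Fin D → Fin (ℓ ^ n)) :
    ∃ w, w.length = n ∧ I w = adicCube D ℓ n k := by
  obtain ⟨w, hw, hk⟩ := (hI.bijOn n).surjOn ⟨k, rfl⟩
  exact ⟨w, hw, hk⟩

theorem measurableSet (w : List (Fin (ℓ ^ D))) : MeasurableSet (I w) := by
  obtain ⟨k, hk⟩ := hI.exists_eq_adicCube w
  rw [hk]
  exact measurableSet_adicCube k

theorem append_subset (u v : List (Fin (ℓ ^ D))) : I (u ++ v) ⊆ I u := by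
  induction v using List.reverseRecOn with
  | nil => simp
  | append_singleton v e ih =>
    rw [← List.append_assoc]
    exact (hI.nested _ _).trans ih

theorem disjoint (hℓ : 0 < ℓ) {u v : List (Fin (ℓ ^ D))} (hl : u.length = v.length)
    (h : u ≠ v) : Disjoint (I u) (I v) := by
  obtain ⟨k, hk⟩ := (hI.bijOn v.length).mapsTo hl
  obtain ⟨k', hk'⟩ := (hI.bijOn v.length).mapsTo (rfl : v.length = v.length)
  rw [← hk, ← hk']
  refine disjoint_adicCube hℓ fun hkk => h ?_
  refine (hI.bijOn v.length).injOn hl rfl ?_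
  rw [← hk, ← hk', hkk]

theorem pairwiseDisjoint_words (hℓ : 0 < ℓ) (n : ℕ) :
    (words (Fin (ℓ ^ D)) n : Set (List (Fin (ℓ ^ D)))).PairwiseDisjoint I := by
  intro u hu v hv huv
  rw [Finset.mem_coe, mem_words] at hu hv
  exact hI.disjoint hℓ (hu.trans hv.symm) huv

theorem biUnion_words (hℓ : 0 < ℓ) (n : ℕ) : ⋃ w ∈ words (Fin (ℓ ^ D)) n, I w = unitCube D := by
  rw [← iUnion_adicCube (n := n) hℓ]
  ext x
  simp only [Set.mem_iUnion, mem_words]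
  constructor
  · rintro ⟨w, rfl, hx⟩
    obtain ⟨k, hk⟩ := hI.exists_eq_adicCube w
    exact ⟨k, hk ▸ hx⟩
  · rintro ⟨k, hx⟩
    obtain ⟨w, hw, hk⟩ := hI.exists_word_eq k
    exact ⟨w, hw, hk ▸ hx⟩

theorem exists_mem (hℓ : 0 < ℓ) (n : ℕ) {x : EuclideanSpace ℝ (Fin D)} (hx : x ∈ unitCube D) :
    ∃ w : List (Fin (ℓ ^ D)), w.length = n ∧ x ∈ I w := by
  rw [← hI.biUnion_words hℓ n] at hx
  simpa using hx

/-- Cubes of one generation are disjoint, so the prefix of `u` as long as `w` has to be `w` itself.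
-/
theorem subset_of_mem (hℓ : 0 < ℓ) {u w : List (Fin (ℓ ^ D))} (hl : w.length ≤ u.length)
    {x : EuclideanSpace ℝ (Fin D)} (hxu : x ∈ I u) (hxw : x ∈ I w) : I u ⊆ I w := by
  have h1 : I u ⊆ I (u.take w.length) := by
    conv_lhs => rw [← List.take_append_drop w.length u]
    exact hI.append_subset _ _
  have h2 : u.take w.length = w := by
    by_contra hne
    exact Set.disjoint_left.1 (hI.disjoint hℓ (by simpa using hl) hne) (h1 hxu) hxw
  rwa [h2] at h1

theorem sum_words_eq (hℓ : 0 < ℓ) (n : ℕ) (f : Set (EuclideanSpace ℝ (Fin D)) → ℝ) :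
    ∑ k, f (adicCube D ℓ n k) = ∑ w ∈ words (Fin (ℓ ^ D)) n, f (I w) := by
  classical
  have h1 : Set.InjOn I (words (Fin (ℓ ^ D)) n) := by
    intro u hu v hv
    exact (hI.bijOn n).injOn (mem_words.1 hu) (mem_words.1 hv)
  rw [← Finset.sum_image (f := f) h1,
    ← Finset.sum_image (f := f) (g := adicCube D ℓ n) (adicCube_injective hℓ).injOn]
  refine Finset.sum_congr ?_ fun _ _ => rfl
  ext S
  simp only [Finset.mem_image, Finset.mem_univ, true_and, mem_words]
  constructor
  · rintro ⟨k, rfl⟩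
    exact hI.exists_word_eq k
  · rintro ⟨w, rfl, rfl⟩
    obtain ⟨k, hk⟩ := hI.exists_eq_adicCube w
    exact ⟨k, hk.symm⟩

variable {m : Measure (EuclideanSpace ℝ (Fin D))}

theorem sum_measureReal (hℓ : 0 < ℓ) (hm : IsQuasiBernoulli I m) (n : ℕ) :
    ∑ w ∈ words (Fin (ℓ ^ D)) n, m.real (I w) = 1 := by
  have := hm.isProbabilityMeasure
  rw [← measureReal_biUnion_finset (hI.pairwiseDisjoint_words hℓ n)
    (fun w _ => hI.measurableSet w), hI.biUnion_words hℓ, Measure.real, unitCube,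
    hm.measure_unitCube, ENNReal.toReal_one]

theorem exists_isQuasiMultiplicative (hℓ : 0 < ℓ) (hm : IsQuasiBernoulli I m) :
    ∃ C, IsQuasiMultiplicative (fun w => m.real (I w)) C := by
  obtain ⟨C, hC, h⟩ := hm.quasi
  exact ⟨C, hC, fun w => measureReal_nonneg, hI.sum_measureReal hℓ hm, fun u v => (h u v).1,
    fun u v => (h u v).2⟩

theorem tauAt_eq (hℓ : 0 < ℓ) (n : ℕ) (q : ℝ) :
    tauAt ℓ m n q = Real.log (partitionSum (fun w => m.real (I w)) n q) / n / Real.log ℓ := by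
  rw [tauAt, Finset.sum_filter, partitionSum, Finset.sum_filter,
    hI.sum_words_eq hℓ n fun S => if 0 < m.real S then m.real S ^ q else 0]
  ring

/-- Almost additivity makes the limsup a limit. The error is uniform in `n`, which is what lets `q`
vary with `n` later. -/
theorem abs_log_partitionSum_sub_tau_le (hℓ : 2 ≤ ℓ) {C : ℝ}
    (h : IsQuasiMultiplicative (fun w => m.real (I w)) C) (n : ℕ) (q : ℝ) :
    |Real.log (partitionSum (fun w => m.real (I w)) n q) - n * (Real.log ℓ * tau ℓ m q)| ≤
      |q| * Real.log C := by
  obtain ⟨L, hL, hn⟩ := exists_tendsto_div_of_almost_additive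
    (a := fun n => Real.log (partitionSum (fun w => m.real (I w)) n q))
    fun n p => h.abs_log_partitionSum_add_sub_le n p q
  have hlog : 0 < Real.log ℓ := Real.log_pos (by exact_mod_cast hℓ)
  have hτ : tau ℓ m q = L / Real.log ℓ := by
    refine Tendsto.limsup_eq ?_
    simp only [hI.tauAt_eq (by omega : 0 < ℓ)]
    exact hL.div_const _
  rw [hτ, mul_div_cancel₀ _ hlog.ne']
  exact hn n

/-- A union of cubes that occupies a fixed proportion of every cube has full measure. -/
theorem measure_compl_eq_zero_of_le (hℓ : 0 < ℓ) (hm : IsQuasiBernoulli I m)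
    {S : Set (List (Fin (ℓ ^ D)))} {c : ℝ} (hc : 0 < c)
    (h : ∀ u, c * m.real (I u) ≤ m.real ((⋃ w ∈ S, I w) ∩ I u)) :
    m (⋃ w ∈ S, I w)ᶜ = 0 := by
  have := hm.isProbabilityMeasure
  set G := ⋃ w ∈ S, I w with hG
  set Gn : ℕ → Set (EuclideanSpace ℝ (Fin D)) := fun n => ⋃ w ∈ {w ∈ S | w.length ≤ n}, I w
    with hGn
  have hmeas : ∀ T : Set (List (Fin (ℓ ^ D))), MeasurableSet (⋃ w ∈ T, I w) := fun T =>
    MeasurableSet.biUnion T.to_countable fun w _ => hI.measurableSet w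
  have hmono : Monotone Gn := fun n p hnp =>
    Set.biUnion_subset_biUnion_left fun w hw => ⟨hw.1, hw.2.trans hnp⟩
  have hunion : ⋃ n, Gn n = G := by
    ext x
    simp only [hGn, hG, Set.mem_iUnion, Set.mem_ofPred_eq, exists_prop]
    exact ⟨fun ⟨n, w, hw, hx⟩ => ⟨w, hw.1, hx⟩, fun ⟨w, hw, hx⟩ => ⟨w.length, w, ⟨hw, le_rfl⟩, hx⟩⟩
  have hsub : ∀ n, Gn n ⊆ G := fun n => hunion ▸ Set.subset_iUnion Gn n
  -- Up to a null set, `Gᶜ` is covered by the cubes of generation `n` that miss `Gn n`, since a cube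
  -- that meets `Gn n` lies in `G`. Each of them has a proportion `c` in `G`, necessarily outside
  -- `Gn n`, and the mass of `G \ Gn n` tends to `0`.
  have hkey : ∀ n, c * m.real Gᶜ ≤ m.real G - m.real (Gn n) := by
    intro n
    classical
    set T := {u ∈ words (Fin (ℓ ^ D)) n | Disjoint (I u) (Gn n)} with hT
    have hTd : (T : Set (List (Fin (ℓ ^ D)))).PairwiseDisjoint I :=
      (hI.pairwiseDisjoint_words hℓ n).subset (Finset.coe_subset.2 (Finset.filter_subset _ _))
    have h1 : Gᶜ ⊆ (unitCube D)ᶜ ∪ ⋃ u ∈ T, I u := by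
      intro x hx
      by_cases hxQ : x ∈ unitCube D
      · right
        obtain ⟨u, hu, hxu⟩ := hI.exists_mem hℓ n hxQ
        refine Set.mem_biUnion (x := u) ?_ hxu
        rw [Finset.mem_coe, hT, Finset.mem_filter, mem_words]
        refine ⟨hu, ?_⟩
        rw [Set.disjoint_left]
        intro y hyu hy
        simp only [hGn, Set.mem_iUnion, exists_prop] at hy
        obtain ⟨w, hw, hyw⟩ := hy
        exact hx (Set.mem_biUnion hw.1
          (hI.subset_of_mem hℓ (hw.2.trans hu.ge) hyu hyw hxu))
      · exact Or.inl hxQ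
    have h2 : m.real Gᶜ ≤ ∑ u ∈ T, m.real (I u) := by
      refine (measureReal_mono h1).trans ((measureReal_union_le _ _).trans ?_)
      rw [Measure.real, hm.measure_unitCube_compl, ENNReal.toReal_zero, zero_add]
      exact measureReal_biUnion_finset_le _ _
    have h3 : ∑ u ∈ T, m.real (G ∩ I u) ≤ m.real (G \ Gn n) := by
      rw [← measureReal_biUnion_finset (hTd.mono fun u => Set.inter_subset_right)
        fun u _ => (hmeas S).inter (hI.measurableSet u)]
      refine measureReal_mono (Set.iUnion₂_subset fun u hu x hx => ⟨hx.1, fun hx' => ?_⟩)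
      exact Set.disjoint_left.1 (Finset.mem_filter.1 hu).2 hx.2 hx'
    calc c * m.real Gᶜ ≤ c * ∑ u ∈ T, m.real (I u) := mul_le_mul_of_nonneg_left h2 hc.le
      _ ≤ ∑ u ∈ T, m.real (G ∩ I u) := by
          rw [Finset.mul_sum]
          exact Finset.sum_le_sum fun u _ => h u
      _ ≤ m.real (G \ Gn n) := h3
      _ = m.real G - m.real (Gn n) := measureReal_sdiff (hsub n) (hmeas _) (measure_ne_top m G)
  have hlim : Tendsto (fun n => m.real G - m.real (Gn n)) atTop (𝓝 0) := by
    have h1 := tendsto_measure_iUnion_atTop (μ := m) hmono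
    rw [hunion] at h1
    have h2 := (ENNReal.tendsto_toReal (measure_ne_top m G)).comp h1
    have h3 := (tendsto_const_nhds (x := m.real G)).sub h2
    simpa [Measure.real] using h3
  have h0 : c * m.real Gᶜ ≤ 0 := ge_of_tendsto' hlim hkey
  have h1 : m.real Gᶜ = 0 :=
    le_antisymm (nonpos_of_mul_nonpos_right h0 hc) measureReal_nonneg
  exact (measureReal_eq_zero_iff).1 h1

/-- The union of the cubes of generation at least `N` whose measure deviates by a factor
`exp (A √n)` from `exp (-n d)` in the direction `s` has full measure. -/
theorem measure_compl_fluctuation_eq_zero (hℓ : 2 ≤ ℓ) (hm : IsQuasiBernoulli I m) {d σ : ℝ}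
    (hσ : 0 < σ)
    (hτ : (fun q : ℝ => tau ℓ m (1 - q) - (q * d + σ ^ 2 / 2 * q ^ 2)) =o[𝓝 0]
      fun q : ℝ => q ^ 2)
    {s : ℝ} (hs : s ^ 2 = 1) {A : ℝ} (hA : 0 ≤ A) (N : ℕ) :
    m (⋃ w ∈ {w : List (Fin (ℓ ^ D)) | N ≤ w.length ∧ 0 < m.real (I w) ∧
      A * √w.length ≤ s * (Real.log (m.real (I w)) + w.length * (Real.log ℓ * d))}, I w)ᶜ = 0 := by
  have := hm.isProbabilityMeasure
  have hℓ0 : 0 < ℓ := by omega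
  have hlog : 0 < Real.log ℓ := Real.log_pos (by exact_mod_cast hℓ)
  obtain ⟨C, hC⟩ := hI.exists_isQuasiMultiplicative hℓ0 hm
  have hC0 : 0 < C := one_pos.trans_le hC.one_le
  -- Passing from base `ℓ` to natural logarithms multiplies the drift and the variance by `log ℓ`.
  have hexp : (fun q => Real.log ℓ * tau ℓ m (1 - q) -
      (q * (Real.log ℓ * d) + Real.log ℓ * σ ^ 2 / 2 * q ^ 2)) =o[𝓝 0] fun q : ℝ => q ^ 2 := by
    refine (hτ.const_mul_left (Real.log ℓ)).congr_left fun q => ?_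
    ring
  obtain ⟨c, hc, hev⟩ := hC.exists_le_sum_fluctuation (by positivity : 0 < Real.log ℓ * σ ^ 2)
    (fun n q => hI.abs_log_partitionSum_sub_tau_le hℓ hC n (1 - q)) hexp hs
    (by linarith : 0 ≤ A + 1)
  refine hI.measure_compl_eq_zero_of_le hℓ0 hm (div_pos hc hC0) fun u => ?_
  rcases (measureReal_nonneg (μ := m) (s := I u)).eq_or_lt with hu | hu
  · rw [← hu, mul_zero]
    exact measureReal_nonneg
  have hsqrt : Tendsto (fun n : ℕ => √(n : ℝ)) atTop atTop :=
    Real.tendsto_sqrt_atTop.comp tendsto_natCast_atTop_atTop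
  -- The prefix `u` contributes a fixed amount, absorbed by the spare `√n` gained from asking for `A
  -- + 1` instead of `A`.
  obtain ⟨n, hn, hnN, hnK⟩ := (hev.and ((eventually_ge_atTop N).and (hsqrt.eventually_ge_atTop
    (A * √u.length + |Real.log (m.real (I u)) + u.length * (Real.log ℓ * d)| +
      Real.log C)))).exists
  set T := {v ∈ words (Fin (ℓ ^ D)) n | 0 < m.real (I v) ∧
    (A + 1) * √n ≤ s * (Real.log (m.real (I v)) + n * (Real.log ℓ * d))} with hT
  have hs1 : |s| = 1 := by
    rw [← abs_one, ← sq_eq_sq_iff_abs_eq_abs, hs, one_pow]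
  have hgood : ∀ v ∈ T, I (u ++ v) ⊆ (⋃ w ∈ {w : List (Fin (ℓ ^ D)) | N ≤ w.length ∧
      0 < m.real (I w) ∧
      A * √w.length ≤ s * (Real.log (m.real (I w)) + w.length * (Real.log ℓ * d))}, I w) ∩ I u := by
    intro v hv
    rw [hT, Finset.mem_filter, mem_words] at hv
    obtain ⟨hvn, hv0, hvA⟩ := hv
    refine Set.subset_inter (Set.subset_biUnion_of_mem (u := I) ⟨?_, ?_, ?_⟩)
      (hI.append_subset u v)
    · rw [List.length_append]
      omega
    · exact (hC.append_pos_iff u v).2 ⟨hu, hv0⟩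
    · rw [List.length_append, hvn]
      push_cast
      have h1 := hC.abs_log_append_sub_le hu hv0
      set e := Real.log (m.real (I (u ++ v))) -
        (Real.log (m.real (I u)) + Real.log (m.real (I v))) with he
      set y := Real.log (m.real (I u)) + u.length * (Real.log ℓ * d) with hy
      have h2 : |s * e| ≤ Real.log C := by rwa [abs_mul, hs1, one_mul]
      have h3 : |s * y| = |y| := by rw [abs_mul, hs1, one_mul]
      have h4 := neg_abs_le (s * y)
      have h5 := neg_abs_le (s * e)
      have h6 : A * √((u.length : ℝ) + n) ≤ A * √u.length + A * √n := by
        rw [← mul_add]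
        refine mul_le_mul_of_nonneg_left ?_ hA
        exact sqrt_add_le_add_sqrt (by positivity) (by positivity)
      have h7 : s * (Real.log (m.real (I (u ++ v))) + (u.length + n) * (Real.log ℓ * d)) =
          s * (Real.log (m.real (I v)) + n * (Real.log ℓ * d)) + s * y + s * e := by
        rw [he, hy]
        ring
      rw [h7]
      linarith
  have hdisj : (T : Set (List (Fin (ℓ ^ D)))).PairwiseDisjoint fun v => I (u ++ v) := by
    intro v hv v' hv' hne
    rw [Finset.mem_coe, hT, Finset.mem_filter, mem_words] at hv hv'
    exact hI.disjoint hℓ0 (by simp [hv.1, hv'.1]) fun h => hne (List.append_cancel_left h)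
  calc c / C * m.real (I u) = 1 / C * (m.real (I u) * c) := by ring
    _ ≤ 1 / C * (m.real (I u) * ∑ v ∈ T, m.real (I v)) := by gcongr
    _ = ∑ v ∈ T, 1 / C * (m.real (I u) * m.real (I v)) := by
        rw [Finset.mul_sum, Finset.mul_sum]
    _ ≤ ∑ v ∈ T, m.real (I (u ++ v)) := Finset.sum_le_sum fun v _ => hC.lower u v
    _ = m.real (⋃ v ∈ T, I (u ++ v)) :=
        (measureReal_biUnion_finset hdisj fun v _ => hI.measurableSet _).symm
    _ ≤ _ := measureReal_mono (Set.iUnion₂_subset hgood)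

end IsCoding

/-! ### Estimates for the gauge -/

theorem tendsto_sqrt_natCast_atTop : Tendsto (fun n : ℕ => √(n : ℝ)) atTop atTop :=
  Real.tendsto_sqrt_atTop.comp tendsto_natCast_atTop_atTop

/-- Used twice: to sum `exp (-√n)`, and to absorb the factor `n ^ 2` between a ball and its cube. -/
theorem eventually_sq_mul_exp_neg_sqrt_le_one :
    ∀ᶠ n : ℕ in atTop, (n : ℝ) ^ 2 * Real.exp (-√n) ≤ 1 := by
  have h := (Real.tendsto_pow_mul_exp_neg_atTop_nhds_zero 4).comp tendsto_sqrt_natCast_atTop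
  filter_upwards [h.eventually_le_const one_pos] with n hn
  have h1 : √(n : ℝ) ^ 4 = (n : ℝ) ^ 2 := by
    rw [show (4 : ℕ) = 2 * 2 from rfl, pow_mul, Real.sq_sqrt (Nat.cast_nonneg n)]
  simpa [h1] using hn

theorem summable_exp_neg_sqrt : Summable fun n : ℕ => Real.exp (-√(n : ℝ)) := by
  refine summable_of_isBigO_nat (Real.summable_one_div_nat_pow.2 one_lt_two)
    (Asymptotics.IsBigO.of_bound 1 ?_)
  filter_upwards [eventually_sq_mul_exp_neg_sqrt_le_one, eventually_gt_atTop 0] with n hn h0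
  have hpos : (0 : ℝ) < (n : ℝ) ^ 2 := by positivity
  rw [one_mul, Real.norm_of_nonneg (Real.exp_pos _).le, Real.norm_of_nonneg (by positivity),
    le_div_iff₀ hpos]
  linarith

section Gauge

variable {ℓ : ℕ} {d a t : ℝ}

theorem psi_eq_exp (hℓ : 0 < ℓ) (ht : 0 < t) :
    psi ℓ d a t = Real.exp (d * Real.log t + Real.log ℓ * (a * √(Real.logb ℓ (1 / t)))) := by
  have hpos : (0 : ℝ) < ℓ := by exact_mod_cast hℓ
  rw [psi, Real.rpow_def_of_pos ht, Real.rpow_def_of_pos hpos, Real.exp_add]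
  ring_nf

theorem sqrt_logb_le (hℓ : 2 ≤ ℓ) {n : ℕ} {K : ℝ}
    (hK : |Real.log t + n * Real.log ℓ| ≤ K) :
    √(Real.logb ℓ (1 / t)) ≤ √n + √(K / Real.log ℓ) := by
  have hlog : 0 < Real.log ℓ := Real.log_pos (by exact_mod_cast hℓ)
  have hK0 : 0 ≤ K := (abs_nonneg _).trans hK
  refine le_trans (Real.sqrt_le_sqrt ?_)
    (sqrt_add_le_add_sqrt (Nat.cast_nonneg n) (by positivity))
  rw [one_div, Real.logb_inv, Real.logb, ← neg_div, div_le_iff₀ hlog, add_mul,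
    div_mul_cancel₀ _ hlog.ne']
  linarith [(abs_le.1 hK).1]

/-- Here and in `exp_le_psi` only the upper bound on the square root serves: the sign of `a` decides
which side of the gauge it controls. -/
theorem psi_le_exp (hℓ : 2 ≤ ℓ) (ha : 0 ≤ a) (ht : 0 < t) {n : ℕ} {K : ℝ}
    (hK : |Real.log t + n * Real.log ℓ| ≤ K) :
    psi ℓ d a t ≤ Real.exp (-(n * (Real.log ℓ * d)) + Real.log ℓ * a * √n +
      (|d| * K + Real.log ℓ * |a| * √(K / Real.log ℓ))) := by
  have hlog : 0 < Real.log ℓ := Real.log_pos (by exact_mod_cast hℓ)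
  rw [psi_eq_exp (by omega) ht, Real.exp_le_exp, abs_of_nonneg ha]
  have h1 := mul_le_mul_of_nonneg_left (sqrt_logb_le hℓ hK) (mul_nonneg hlog.le ha)
  have h2 := (le_abs_self (d * (Real.log t + n * Real.log ℓ))).trans_eq (abs_mul _ _)
  have h3 := mul_le_mul_of_nonneg_left hK (abs_nonneg d)
  linarith

theorem exp_le_psi (hℓ : 2 ≤ ℓ) (ha : a ≤ 0) (ht : 0 < t) {n : ℕ} {K : ℝ}
    (hK : |Real.log t + n * Real.log ℓ| ≤ K) :
    Real.exp (-(n * (Real.log ℓ * d)) + Real.log ℓ * a * √n -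
      (|d| * K + Real.log ℓ * |a| * √(K / Real.log ℓ))) ≤ psi ℓ d a t := by
  have hlog : 0 < Real.log ℓ := Real.log_pos (by exact_mod_cast hℓ)
  rw [psi_eq_exp (by omega) ht, Real.exp_le_exp, abs_of_nonpos ha]
  have h1 := mul_le_mul_of_nonneg_left (sqrt_logb_le hℓ hK)
    (mul_nonneg hlog.le (neg_nonneg.2 ha))
  have h2 := (neg_le_abs (d * (Real.log t + n * Real.log ℓ))).trans_eq (abs_mul _ _)
  have h3 := mul_le_mul_of_nonneg_left hK (abs_nonneg d)
  linarith

end Gauge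

/-! ### Diameters of adic cubes -/

section Diameter

variable {D ℓ n : ℕ}

theorem dist_le_sqrt_mul {x y : EuclideanSpace ℝ (Fin D)} {r : ℝ} (hr : 0 ≤ r)
    (h : ∀ i, |x i - y i| ≤ r) : dist x y ≤ √D * r := by
  rw [EuclideanSpace.dist_eq, Real.sqrt_le_left (by positivity), mul_pow,
    Real.sq_sqrt (Nat.cast_nonneg D)]
  calc ∑ i, dist (x i) (y i) ^ 2 ≤ ∑ _i : Fin D, r ^ 2 :=
        Finset.sum_le_sum fun i _ => pow_le_pow_left₀ dist_nonneg (h i) 2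
    _ = D * r ^ 2 := by simp

theorem abs_sub_le_dist (x y : EuclideanSpace ℝ (Fin D)) (i : Fin D) : |x i - y i| ≤ dist x y := by
  rw [dist_eq_norm]
  exact PiLp.norm_apply_le (x - y) i

theorem ediam_adicCube_le (hℓ : 0 < ℓ) (k : Fin D → Fin (ℓ ^ n)) :
    Metric.ediam (adicCube D ℓ n k) ≤ ENNReal.ofReal (√D * ((ℓ : ℝ) ^ n)⁻¹) := by
  refine Metric.ediam_le fun x hx y hy => ?_
  rw [edist_dist]
  refine ENNReal.ofReal_le_ofReal (dist_le_sqrt_mul (by positivity) fun i => ?_)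
  have h1 := hx i
  have h2 := hy i
  rw [Set.mem_Ico, add_div, one_div] at h1 h2
  rw [abs_le]
  constructor <;> linarith

theorem le_ediam_adicCube (hD : 1 ≤ D) (hℓ : 0 < ℓ) (k : Fin D → Fin (ℓ ^ n)) :
    ENNReal.ofReal (((ℓ : ℝ) ^ n)⁻¹ / 2) ≤ Metric.ediam (adicCube D ℓ n k) := by
  have hpos : (0 : ℝ) < (ℓ : ℝ) ^ n := by positivity
  set x : EuclideanSpace ℝ (Fin D) := WithLp.toLp 2 fun i => ((k i : ℕ) : ℝ) / (ℓ : ℝ) ^ n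
  -- The centre of the cube; the opposite corner is excluded by half-openness.
  set y : EuclideanSpace ℝ (Fin D) :=
    WithLp.toLp 2 fun i => (((k i : ℕ) : ℝ) + 1 / 2) / (ℓ : ℝ) ^ n
  have hx : x ∈ adicCube D ℓ n k := fun i =>
    ⟨le_rfl, div_lt_div_of_pos_right (lt_add_one _) hpos⟩
  have hy : y ∈ adicCube D ℓ n k := fun i =>
    ⟨div_le_div_of_nonneg_right (by linarith) hpos.le,
      div_lt_div_of_pos_right (by linarith) hpos⟩
  refine le_trans ?_ (Metric.edist_le_ediam_of_mem hy hx)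
  rw [edist_dist]
  refine ENNReal.ofReal_le_ofReal (le_trans ?_ (abs_sub_le_dist y x ⟨0, hD⟩))
  have h1 : y ⟨0, hD⟩ - x ⟨0, hD⟩ = ((ℓ : ℝ) ^ n)⁻¹ / 2 := by
    change (((k ⟨0, hD⟩ : ℕ) : ℝ) + 1 / 2) / (ℓ : ℝ) ^ n - ((k ⟨0, hD⟩ : ℕ) : ℝ) / (ℓ : ℝ) ^ n = _
    ring
  rw [h1]
  exact le_abs_self _

theorem abs_log_ediam_adicCube_le (hD : 1 ≤ D) (hℓ : 0 < ℓ) (k : Fin D → Fin (ℓ ^ n)) :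
    0 < (Metric.ediam (adicCube D ℓ n k)).toReal ∧
      |Real.log (Metric.ediam (adicCube D ℓ n k)).toReal + n * Real.log ℓ| ≤
        Real.log 2 + Real.log √D := by
  have hpos : (0 : ℝ) < (ℓ : ℝ) ^ n := by positivity
  have hD' : (1 : ℝ) ≤ √D := Real.one_le_sqrt.2 (by exact_mod_cast hD)
  have hu := ediam_adicCube_le hℓ k
  have hl := le_ediam_adicCube hD hℓ k
  have htop : Metric.ediam (adicCube D ℓ n k) ≠ ⊤ := ne_top_of_le_ne_top ENNReal.ofReal_ne_top hu
  have h1 := ENNReal.toReal_le_of_le_ofReal (by positivity) hu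
  have h2 := (ENNReal.ofReal_le_iff_le_toReal htop).1 hl
  have h0 : 0 < (Metric.ediam (adicCube D ℓ n k)).toReal := lt_of_lt_of_le (by positivity) h2
  refine ⟨h0, ?_⟩
  have h3 := Real.log_le_log h0 h1
  have h4 := Real.log_le_log (by positivity) h2
  rw [Real.log_mul (by positivity) (by positivity), Real.log_inv, Real.log_pow] at h3
  rw [Real.log_div (by positivity) (by positivity), Real.log_inv, Real.log_pow] at h4
  have h5 : 0 ≤ Real.log 2 := Real.log_nonneg one_le_two
  have h6 := Real.log_nonneg hD'
  rw [abs_le]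
  constructor <;> linarith

end Diameter

/-! ### Singularity with respect to Hausdorff measures -/

theorem IsCoding.mutuallySingular_hausdorffGauge {D ℓ : ℕ} (hD : 1 ≤ D) (hℓ : 2 ≤ ℓ)
    {I : List (Fin (ℓ ^ D)) → Set (EuclideanSpace ℝ (Fin D))} (hI : IsCoding D ℓ I)
    {m : Measure (EuclideanSpace ℝ (Fin D))} (hm : IsQuasiBernoulli I m) {d σ : ℝ} (hσ : 0 < σ)
    (hτ : (fun q : ℝ => tau ℓ m (1 - q) - (q * d + σ ^ 2 / 2 * q ^ 2)) =o[𝓝 0]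
      fun q : ℝ => q ^ 2)
    {a : ℝ} (ha : 0 ≤ a) : m ⟂ₘ hausdorffGauge (psi ℓ d a) := by
  have := hm.isProbabilityMeasure
  have hℓ0 : 0 < ℓ := by omega
  have hlog : 0 < Real.log ℓ := Real.log_pos (by exact_mod_cast hℓ)
  -- The first term compensates the correction in the gauge; the `1` leaves the summable factor `exp
  -- (-√n)`.
  set A := Real.log ℓ * a + 1 with hA
  set K := Real.log 2 + Real.log √D with hK
  set M := |d| * K + Real.log ℓ * |a| * √(K / Real.log ℓ) with hM
  set good : List (Fin (ℓ ^ D)) → Prop := fun w => 0 < m.real (I w) ∧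
    A * √w.length ≤ 1 * (Real.log (m.real (I w)) + w.length * (Real.log ℓ * d)) with hgood
  set G : ℕ → Set (EuclideanSpace ℝ (Fin D)) := fun N => ⋃ w ∈ {w | N ≤ w.length ∧ good w}, I w
    with hG
  have hGmeas : ∀ N, MeasurableSet (G N) := fun N =>
    MeasurableSet.biUnion (Set.to_countable _) fun w _ => hI.measurableSet w
  have hfull : ∀ N, m (G N)ᶜ = 0 := fun N =>
    hI.measure_compl_fluctuation_eq_zero hℓ hm hσ hτ (one_pow 2) (by positivity : 0 ≤ A) N
  have hψ : ∀ w, good w → ENNReal.ofReal (psi ℓ d a (Metric.ediam (I w)).toReal) ≤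
      ENNReal.ofReal (Real.exp M * Real.exp (-√w.length) * m.real (I w)) := by
    intro w hw
    refine ENNReal.ofReal_le_ofReal ?_
    obtain ⟨k, hk⟩ := hI.exists_eq_adicCube w
    have h1 := abs_log_ediam_adicCube_le hD hℓ0 k
    rw [← hk] at h1
    refine (psi_le_exp hℓ ha h1.1 h1.2).trans ?_
    rw [← Real.exp_add, ← Real.exp_log hw.1, ← Real.exp_add, Real.exp_le_exp]
    have h2 := hw.2
    rw [one_mul, hA] at h2
    linarith
  set c : ℕ → ℝ≥0∞ := fun n => ENNReal.ofReal (Real.exp M * Real.exp (-√n)) with hc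
  have hcsum : ∑' n, c n ≠ ⊤ := (summable_exp_neg_sqrt.mul_left (Real.exp M)).tsum_ofReal_ne_top
  classical
  set T : ℕ → Finset (List (Fin (ℓ ^ D))) := fun n => {w ∈ words (Fin (ℓ ^ D)) n | good w} with hT
  have hsumT : ∀ n, ∑ w ∈ T n, ENNReal.ofReal (psi ℓ d a (Metric.ediam (I w)).toReal) ≤ c n := by
    intro n
    calc ∑ w ∈ T n, ENNReal.ofReal (psi ℓ d a (Metric.ediam (I w)).toReal)
        ≤ ∑ w ∈ T n, ENNReal.ofReal (Real.exp M * Real.exp (-√n) * m.real (I w)) := by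
          refine Finset.sum_le_sum fun w hw => ?_
          rw [hT, Finset.mem_filter, mem_words] at hw
          rw [← hw.1]
          exact hψ w hw.2
      _ = ENNReal.ofReal (∑ w ∈ T n, Real.exp M * Real.exp (-√n) * m.real (I w)) :=
          (ENNReal.ofReal_sum_of_nonneg fun w _ => by positivity).symm
      _ ≤ c n := by
          refine ENNReal.ofReal_le_ofReal ?_
          rw [← Finset.mul_sum]
          refine mul_le_of_le_one_right (by positivity) ?_
          rw [← hI.sum_measureReal hℓ0 hm n]
          exact Finset.sum_le_sum_of_subset_of_nonneg (Finset.filter_subset _ _)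
            fun w _ _ => measureReal_nonneg
  have hH : hausdorffGauge (psi ℓ d a) (⋂ N, G N) = 0 := by
    have hr : Tendsto (fun N : ℕ => ENNReal.ofReal (√D * ((ℓ : ℝ) ^ N)⁻¹)) atTop (𝓝 0) := by
      rw [← ENNReal.ofReal_zero, ← mul_zero √(D : ℝ)]
      refine ENNReal.tendsto_ofReal (Tendsto.const_mul _ ?_)
      exact (tendsto_pow_atTop_atTop_of_one_lt (by exact_mod_cast hℓ)).inv_tendsto_atTop
    -- For each `N` the good cubes of generation at least `N` cover the limsup set, at a cost
    -- bounded by the tail of a convergent series.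
    have h1 := Measure.mkMetric_le_liminf_tsum (β := ℕ) (l := atTop)
      (ι := fun N => Σ n : ℕ, T (n + N)) (⋂ N, G N) _ hr (fun N i => I i.2)
      (Eventually.of_forall fun N i => by
        obtain ⟨n, w, hw⟩ := i
        rw [hT, Finset.mem_filter, mem_words] at hw
        obtain ⟨k, hk⟩ := hI.exists_eq_adicCube w
        simp only [hk]
        refine (ediam_adicCube_le hℓ0 k).trans (ENNReal.ofReal_le_ofReal ?_)
        have h1 : (1 : ℝ) ≤ ℓ := by exact_mod_cast hℓ0
        have h2 : N ≤ w.length := by omega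
        gcongr)
      (Eventually.of_forall fun N x hx => by
        have hxN := Set.mem_iInter.1 hx N
        simp only [hG, Set.mem_iUnion, exists_prop] at hxN
        obtain ⟨w, ⟨hN, hw⟩, hxw⟩ := hxN
        refine Set.mem_iUnion.2 ⟨⟨w.length - N, ⟨w, ?_⟩⟩, hxw⟩
        rw [hT, Finset.mem_filter, mem_words]
        exact ⟨by omega, hw⟩)
      (fun t => ENNReal.ofReal (psi ℓ d a t.toReal))
    refine le_antisymm (h1.trans ?_) bot_le
    have h2 := ENNReal.tendsto_sum_nat_add c hcsum
    rw [← h2.liminf_eq]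
    refine liminf_le_liminf (Eventually.of_forall fun N => ?_)
    rw [ENNReal.tsum_sigma (α := ℕ) (β := fun n => T (n + N))
      fun n w => ENNReal.ofReal (psi ℓ d a (Metric.ediam (I w)).toReal)]
    refine ENNReal.tsum_le_tsum fun n => ?_
    rw [Finset.tsum_subtype (T (n + N))
      fun w => ENNReal.ofReal (psi ℓ d a (Metric.ediam (I w)).toReal)]
    exact hsumT (n + N)
  refine ⟨(⋂ N, G N)ᶜ, (MeasurableSet.iInter hGmeas).compl, ?_, by rwa [compl_compl]⟩
  rw [Set.compl_iInter]
  exact measure_iUnion_null hfull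

/-! ### Absolute continuity with respect to packing measures -/

/-- The indices of the cubes adjacent to the cube with index `k`. -/
def neighbours {D ℓ n : ℕ} (k : Fin D → Fin (ℓ ^ n)) : Finset (Fin D → Fin (ℓ ^ n)) :=
  Fintype.piFinset fun i => {j | (j : ℕ) ≤ k i + 1 ∧ (k i : ℕ) ≤ j + 1}

section Neighbours

variable {D ℓ n : ℕ}

theorem mem_neighbours {k k' : Fin D → Fin (ℓ ^ n)} :
    k' ∈ neighbours k ↔ ∀ i, (k' i : ℕ) ≤ k i + 1 ∧ (k i : ℕ) ≤ k' i + 1 := by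
  simp [neighbours]

theorem mem_neighbours_comm {k k' : Fin D → Fin (ℓ ^ n)} :
    k' ∈ neighbours k ↔ k ∈ neighbours k' := by
  simp only [mem_neighbours, and_comm]

theorem card_neighbours_le (k : Fin D → Fin (ℓ ^ n)) : (neighbours k).card ≤ 3 ^ D := by
  rw [neighbours, Fintype.card_piFinset]
  refine (Finset.prod_le_prod' fun i _ => ?_).trans_eq
    (by rw [Finset.prod_const, Finset.card_univ, Fintype.card_fin])
  have h1 : (Finset.Icc ((k i : ℕ) - 1) (k i + 1)).card ≤ 3 := by
    rw [Nat.card_Icc]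
    omega
  refine le_trans (Finset.card_le_card_of_injOn (fun j : Fin (ℓ ^ n) => (j : ℕ)) ?_
    Fin.val_injective.injOn) h1
  intro j hj
  simp only [Finset.coe_filter, Finset.mem_univ, true_and, Set.mem_ofPred_eq] at hj
  simp only [Finset.coe_Icc, Set.mem_Icc]
  omega

/-- The radius is the side of the cubes, so each coordinate index moves by less than two, hence by
at most one. -/
theorem closedBall_inter_unitCube_subset (hℓ : 0 < ℓ) {k : Fin D → Fin (ℓ ^ n)}
    {x : EuclideanSpace ℝ (Fin D)} (hx : x ∈ adicCube D ℓ n k) :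
    Metric.closedBall x ((ℓ : ℝ) ^ n)⁻¹ ∩ unitCube D ⊆
      ⋃ k' ∈ neighbours k, adicCube D ℓ n k' := by
  rintro y ⟨hy, hyQ⟩
  have hpos : (0 : ℝ) < (ℓ : ℝ) ^ n := by positivity
  rw [← iUnion_adicCube (n := n) hℓ] at hyQ
  obtain ⟨k', hk'⟩ := Set.mem_iUnion.1 hyQ
  refine Set.mem_biUnion (x := k') ?_ hk'
  rw [Finset.mem_coe, mem_neighbours]
  intro i
  have h1 := (abs_sub_le_dist y x i).trans hy
  rw [← one_div, le_div_iff₀ hpos, ← abs_of_pos hpos, ← abs_mul, abs_le] at h1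
  have hxi := hx i
  have hyi := hk' i
  rw [Set.mem_Ico, div_le_iff₀ hpos, lt_div_iff₀ hpos] at hxi hyi
  constructor
  · have : ((k' i : ℕ) : ℝ) < (k i : ℕ) + 1 + 1 := by linarith
    exact Nat.lt_succ_iff.1 (by exact_mod_cast this)
  · have : ((k i : ℕ) : ℝ) < (k' i : ℕ) + 1 + 1 := by linarith
    exact Nat.lt_succ_iff.1 (by exact_mod_cast this)

theorem sum_sum_neighbours_le {f : (Fin D → Fin (ℓ ^ n)) → ℝ} (hf : ∀ k, 0 ≤ f k) :
    ∑ k, ∑ k' ∈ neighbours k, f k' ≤ 3 ^ D * ∑ k, f k := by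
  rw [Finset.sum_comm' (t' := Finset.univ) (s' := neighbours)
    (by simp [mem_neighbours_comm]), Finset.mul_sum]
  refine Finset.sum_le_sum fun k _ => ?_
  rw [Finset.sum_const, nsmul_eq_mul]
  refine mul_le_mul_of_nonneg_right ?_ (hf k)
  exact_mod_cast card_neighbours_le k

end Neighbours

namespace IsCoding

variable {D ℓ : ℕ} {I : List (Fin (ℓ ^ D)) → Set (EuclideanSpace ℝ (Fin D))}
  (hI : IsCoding D ℓ I) {m : Measure (EuclideanSpace ℝ (Fin D))}

include hI

/-- Almost surely the ball of radius `ℓ ^ (-n)` about `x` is at most `n ^ 2` times as heavy as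
the cube of generation `n` around `x`, for all large `n`. -/
theorem ae_eventually_measureReal_closedBall_le (hℓ : 0 < ℓ) (hm : IsQuasiBernoulli I m) :
    ∀ᵐ x ∂m, ∀ᶠ n : ℕ in atTop, ∀ w : List (Fin (ℓ ^ D)), w.length = n → x ∈ I w →
      m.real (Metric.closedBall x ((ℓ : ℝ) ^ n)⁻¹) ≤ n ^ 2 * m.real (I w) := by
  have := hm.isProbabilityMeasure
  classical
  set near : (n : ℕ) → (Fin D → Fin (ℓ ^ n)) → ℝ := fun n k =>
    ∑ k' ∈ neighbours k, m.real (adicCube D ℓ n k') with hnear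
  set bad : (n : ℕ) → Finset (Fin D → Fin (ℓ ^ n)) := fun n =>
    {k | (n : ℝ) ^ 2 * m.real (adicCube D ℓ n k) < near n k} with hbad
  have hsum : ∀ n, ∑ k, m.real (adicCube D ℓ n k) = 1 := fun n => by
    rw [hI.sum_words_eq hℓ n fun S => m.real S, hI.sum_measureReal hℓ hm]
  -- Markov's inequality: each cube is counted by at most `3 ^ D` neighbours, so the bad cubes have
  -- mass at most `3 ^ D / n ^ 2`, which is summable.
  have hle : ∀ n : ℕ, n ≠ 0 → m.real (⋃ k ∈ bad n, adicCube D ℓ n k) ≤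
      3 ^ D * (1 / (n : ℝ) ^ 2) := by
    intro n hn
    have hpos : (0 : ℝ) < (n : ℝ) ^ 2 := by positivity
    rw [mul_one_div, le_div_iff₀ hpos, mul_comm]
    calc (n : ℝ) ^ 2 * m.real (⋃ k ∈ bad n, adicCube D ℓ n k)
        ≤ (n : ℝ) ^ 2 * ∑ k ∈ bad n, m.real (adicCube D ℓ n k) :=
          mul_le_mul_of_nonneg_left (measureReal_biUnion_finset_le _ _) hpos.le
      _ ≤ ∑ k ∈ bad n, near n k := by
          rw [Finset.mul_sum]
          exact Finset.sum_le_sum fun k hk => (Finset.mem_filter.1 hk).2.le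
      _ ≤ ∑ k, near n k := Finset.sum_le_sum_of_subset_of_nonneg (Finset.filter_subset _ _)
          fun k _ _ => Finset.sum_nonneg fun k' _ => measureReal_nonneg
      _ ≤ 3 ^ D * ∑ k, m.real (adicCube D ℓ n k) :=
          sum_sum_neighbours_le fun k => measureReal_nonneg
      _ = 3 ^ D := by rw [hsum, mul_one]
  have hsummable : Summable fun n : ℕ => m.real (⋃ k ∈ bad n, adicCube D ℓ n k) := by
    refine summable_of_isBigO_nat (Real.summable_one_div_nat_pow.2 one_lt_two)
      (Asymptotics.IsBigO.of_bound (3 ^ D) ?_)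
    filter_upwards [eventually_ne_atTop 0] with n hn
    rw [Real.norm_of_nonneg measureReal_nonneg, Real.norm_of_nonneg (by positivity)]
    exact hle n hn
  have htsum : ∑' n, m (⋃ k ∈ bad n, adicCube D ℓ n k) ≠ ⊤ := by
    have := hsummable.tsum_ofReal_ne_top
    simpa [ofReal_measureReal] using this
  filter_upwards [ae_eventually_notMem htsum] with x hx
  filter_upwards [hx] with n hn w hw hxw
  subst hw
  obtain ⟨k, hk⟩ := hI.exists_eq_adicCube w
  rw [hk] at hxw ⊢
  have hkbad : ¬(w.length : ℝ) ^ 2 * m.real (adicCube D ℓ w.length k) < near w.length k := by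
    intro hlt
    exact hn (Set.mem_biUnion (x := k) (Finset.mem_filter.2 ⟨Finset.mem_univ k, hlt⟩) hxw)
  refine le_trans ?_ (not_lt.1 hkbad)
  have hsub : Metric.closedBall x ((ℓ : ℝ) ^ w.length)⁻¹ ⊆
      (unitCube D)ᶜ ∪ ⋃ k' ∈ neighbours k, adicCube D ℓ w.length k' := by
    intro y hy
    by_cases hyQ : y ∈ unitCube D
    · exact Or.inr (closedBall_inter_unitCube_subset hℓ hxw ⟨hy, hyQ⟩)
    · exact Or.inl hyQ
  refine (measureReal_mono hsub).trans ((measureReal_union_le _ _).trans ?_)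
  rw [Measure.real, hm.measure_unitCube_compl, ENNReal.toReal_zero, zero_add]
  exact measureReal_biUnion_finset_le _ _

theorem ae_exists_measureReal_closedBall_le_psi (hℓ : 2 ≤ ℓ) (hm : IsQuasiBernoulli I m)
    {d σ : ℝ} (hσ : 0 < σ)
    (hτ : (fun q : ℝ => tau ℓ m (1 - q) - (q * d + σ ^ 2 / 2 * q ^ 2)) =o[𝓝 0]
      fun q : ℝ => q ^ 2)
    {a : ℝ} (ha : a ≤ 0) :
    ∀ᵐ x ∂m, ∀ ε > 0, ∀ δ > 0, ∃ r, 0 < r ∧ r ≤ δ ∧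
      m.real (Metric.closedBall x (5 * r)) ≤ ε * psi ℓ d a (2 * r) := by
  have := hm.isProbabilityMeasure
  have hℓ0 : 0 < ℓ := by omega
  have hℓ1 : (1 : ℝ) < ℓ := by exact_mod_cast hℓ
  have hlog : 0 < Real.log ℓ := Real.log_pos hℓ1
  -- The first term compensates the gauge. One of the two spare `√n` absorbs `n ^ 2`, the other
  -- absorbs `M - log ε`.
  set A := Real.log ℓ * |a| + 2 with hA
  -- With `r = ℓ ^ (-n) / 5` the enlarged ball has radius `ℓ ^ (-n)`, and the gauge is evaluated at
  -- `2r = (2/5) ℓ ^ (-n)`.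
  set K := |Real.log (2 / 5)| with hK
  set M := |d| * K + Real.log ℓ * |a| * √(K / Real.log ℓ) with hM
  have hfull := ae_all_iff.2 fun N => mem_ae_iff.2 (hI.measure_compl_fluctuation_eq_zero hℓ hm hσ
    hτ (by norm_num : (-1 : ℝ) ^ 2 = 1) (by positivity : 0 ≤ A) N)
  filter_upwards [hfull, hI.ae_eventually_measureReal_closedBall_le hℓ0 hm]
    with x hx hball ε hε δ hδ
  have hr0 : Tendsto (fun n : ℕ => ((ℓ : ℝ) ^ n)⁻¹ / 5) atTop (𝓝 0) := by
    simpa using (tendsto_pow_atTop_atTop_of_one_lt hℓ1).inv_tendsto_atTop.div_const (5 : ℝ)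
  obtain ⟨N, hN⟩ := eventually_atTop.1 (hball.and (eventually_sq_mul_exp_neg_sqrt_le_one.and
    ((hr0.eventually_le_const hδ).and
      (tendsto_sqrt_natCast_atTop.eventually_ge_atTop (M - Real.log ε)))))
  obtain ⟨w, ⟨hwN, hw0, hwA⟩, hxw⟩ := Set.mem_iUnion₂.1 (hx N)
  obtain ⟨h1, h2, h3, h4⟩ := hN w.length hwN
  have hr : (0 : ℝ) < ((ℓ : ℝ) ^ w.length)⁻¹ / 5 := by positivity
  refine ⟨((ℓ : ℝ) ^ w.length)⁻¹ / 5, hr, h3, ?_⟩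
  rw [mul_div_cancel₀ _ (by norm_num : (5 : ℝ) ≠ 0)]
  have hlogr : |Real.log (2 * (((ℓ : ℝ) ^ w.length)⁻¹ / 5)) + w.length * Real.log ℓ| ≤ K := by
    rw [show 2 * (((ℓ : ℝ) ^ w.length)⁻¹ / 5) = 2 / 5 * ((ℓ : ℝ) ^ w.length)⁻¹ by ring,
      Real.log_mul (by norm_num) (by positivity), Real.log_inv, Real.log_pow, neg_add_cancel_right]
  have hψ := exp_le_psi (d := d) hℓ ha (by positivity) hlogr
  refine (h1 w rfl hxw).trans (le_trans ?_ (mul_le_mul_of_nonneg_left hψ hε.le))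
  have h5 : ((w.length : ℝ)) ^ 2 ≤ Real.exp √w.length := by
    rw [Real.exp_neg, ← div_eq_mul_inv, div_le_one (Real.exp_pos _)] at h2
    exact h2
  calc (w.length : ℝ) ^ 2 * m.real (I w)
      ≤ Real.exp √w.length * Real.exp (Real.log (m.real (I w))) := by
        rw [Real.exp_log hw0]
        gcongr
    _ ≤ Real.exp (Real.log ε) * Real.exp (-(w.length * (Real.log ℓ * d)) +
          Real.log ℓ * a * √w.length - M) := by
        rw [← Real.exp_add, ← Real.exp_add, Real.exp_le_exp]
        rw [hA, abs_of_nonpos ha] at hwA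
        linarith
    _ = _ := by rw [Real.exp_log hε]

end IsCoding

/-- A set of finite packing pre-measure on which the lower density of `m` vanishes is `m`-null. -/
theorem measure_eq_zero_of_packingPre_ne_top {X : Type*} [MetricSpace X]
    [TopologicalSpace.SeparableSpace X] [MeasurableSpace X] {m : Measure X} [IsFiniteMeasure m]
    {ψ : ℝ → ℝ} {E : Set X} (hfin : packingPre ψ E ≠ ⊤)
    (hE : ∀ x ∈ E, ∀ ε > 0, ∀ δ > 0, ∃ r, 0 < r ∧ r ≤ δ ∧
      m.real (Metric.closedBall x (5 * r)) ≤ ε * ψ (2 * r)) : m E = 0 := by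
  obtain ⟨δ, hδ, hlt⟩ : ∃ δ : ℝ, 0 < δ ∧ packingAt ψ δ E < ⊤ := by
    simpa [packingPre, iInf_lt_iff] using hfin.lt_top
  have hkey : ∀ ε : ℝ, 0 < ε → m E ≤ ENNReal.ofReal ε * packingAt ψ δ E := by
    intro ε hε
    -- The selected disjoint balls form a packing of `E`, while their fivefold enlargements cover
    -- `E`; this is why the density hypothesis compares radius `5r` with `ψ(2r)`.
    obtain ⟨u, hut, hdisj, hcov⟩ := Vitali.exists_disjoint_subfamily_covering_enlargement_closedBall
      {b : X × ℝ | b.1 ∈ E ∧ 0 < b.2 ∧ b.2 ≤ δ ∧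
        m.real (Metric.closedBall b.1 (5 * b.2)) ≤ ε * ψ (2 * b.2)}
      Prod.fst Prod.snd δ (fun b hb => hb.2.2.1) 5 (by norm_num)
    have hcount : u.Countable := hdisj.countable_of_nonempty_interior fun b hb =>
      ⟨b.1, Metric.ball_subset_interior_closedBall (Metric.mem_ball_self (hut hb).2.1)⟩
    have hpack : IsPacking δ E u := ⟨hcount, fun b hb => (hut hb).1, fun b hb => (hut hb).2.1,
      fun b hb => (hut hb).2.2.1, hdisj⟩
    have hsub : E ⊆ ⋃ b ∈ u, Metric.closedBall b.1 (5 * b.2) := by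
      intro x hx
      obtain ⟨r, hr, hrδ, hψ⟩ := hE x hx ε hε δ hδ
      obtain ⟨b, hb, hsub⟩ := hcov (x, r) ⟨hx, hr, hrδ, hψ⟩
      exact Set.mem_biUnion hb (hsub (Metric.mem_closedBall_self hr.le))
    calc m E ≤ ∑' b : u, m (Metric.closedBall b.1.1 (5 * b.1.2)) :=
          (measure_mono hsub).trans (measure_biUnion_le m hcount _)
      _ ≤ ∑' b : u, ENNReal.ofReal ε * ENNReal.ofReal (ψ (2 * b.1.2)) := by
          refine ENNReal.tsum_le_tsum fun b => ?_
          rw [← ENNReal.ofReal_mul hε.le, ← ofReal_measureReal]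
          exact ENNReal.ofReal_le_ofReal (hut b.2).2.2.2
      _ = ENNReal.ofReal ε * ∑' b : u, ENNReal.ofReal (ψ (2 * b.1.2)) := ENNReal.tsum_mul_left
      _ ≤ ENNReal.ofReal ε * packingAt ψ δ E :=
          mul_le_mul_right (le_iSup₂ (f := fun (p : Set (X × ℝ)) (_ : IsPacking δ E p) =>
            ∑' b : p, ENNReal.ofReal (ψ (2 * b.1.2))) u hpack) _
  have hlim : Tendsto (fun ε : ℝ => ENNReal.ofReal ε * packingAt ψ δ E) (𝓝[>] 0) (𝓝 0) := by
    have h1 : Tendsto (fun ε : ℝ => ENNReal.ofReal ε) (𝓝[>] 0) (𝓝 0) := by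
      rw [← ENNReal.ofReal_zero]
      exact ENNReal.tendsto_ofReal (tendsto_id.mono_left nhdsWithin_le_nhds)
    simpa using ENNReal.Tendsto.mul_const h1 (Or.inr hlt.ne)
  refine le_antisymm (ge_of_tendsto hlim ?_) bot_le
  filter_upwards [self_mem_nhdsWithin] with ε hε using hkey ε hε

/-- A set of zero packing measure has a countable cover by pieces of finite pre-measure, and each
piece is `m`-null on the set where the lower density vanishes. -/
theorem absolutelyContinuous_packingGauge {X : Type*} [MetricSpace X]
    [TopologicalSpace.SeparableSpace X] [MeasurableSpace X] [BorelSpace X] {m : Measure X}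
    [IsFiniteMeasure m] {ψ : ℝ → ℝ}
    (h : ∀ᵐ x ∂m, ∀ ε > 0, ∀ δ > 0, ∃ r, 0 < r ∧ r ≤ δ ∧
      m.real (Metric.closedBall x (5 * r)) ≤ ε * ψ (2 * r)) : m ≪ packingGauge ψ := by
  refine Measure.AbsolutelyContinuous.mk fun s hs hzero => ?_
  rw [packingGauge, toMeasure_apply _ _ hs, packingOuter, OuterMeasure.ofFunction_apply] at hzero
  obtain ⟨U, hU, hlt⟩ : ∃ U : ℕ → Set X, s ⊆ ⋃ i, U i ∧ ∑' i, packingPre ψ (U i) < ⊤ := by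
    have := hzero.trans_lt ENNReal.zero_lt_top
    simpa [iInf_lt_iff] using this
  set F := {x | ∀ ε > 0, ∀ δ > 0, ∃ r, 0 < r ∧ r ≤ δ ∧
    m.real (Metric.closedBall x (5 * r)) ≤ ε * ψ (2 * r)} with hF
  have hnull : ∀ i, m (U i ∩ F) = 0 := fun i =>
    measure_eq_zero_of_packingPre_ne_top
      (ne_top_of_le_ne_top (ENNReal.ne_top_of_tsum_ne_top hlt.ne i)
        (packingPre_mono ψ Set.inter_subset_left)) fun x hx => hx.2
  refine measure_mono_null (t := Fᶜ ∪ ⋃ i, U i ∩ F) ?_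
    (measure_union_null (mem_ae_iff.1 h) (measure_iUnion_null hnull))
  intro x hx
  by_cases hxF : x ∈ F
  · obtain ⟨i, hi⟩ := Set.mem_iUnion.1 (hU hx)
    exact Or.inr (Set.mem_iUnion.2 ⟨i, hi, hxF⟩)
  · exact Or.inl hxF

end QuasiBernoulli

end

theorem mainTheorem8 (D ℓ : ℕ) (hD : 1 ≤ D) (hℓ : 2 ≤ ℓ)
    (I : List (Fin (ℓ ^ D)) → Set (EuclideanSpace ℝ (Fin D)))
    (hI : QuasiBernoulli.IsCoding D ℓ I)
    (m : Measure (EuclideanSpace ℝ (Fin D)))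
    (hm : QuasiBernoulli.IsQuasiBernoulli I m)
    (d : ℝ) (hd : d = -deriv (QuasiBernoulli.tau ℓ m) 1)
    (σ : ℝ) (hσ : 0 < σ)
    (hτ : (fun q : ℝ => QuasiBernoulli.tau ℓ m (1 - q) - (q * d + σ ^ 2 / 2 * q ^ 2))
      =o[𝓝 0] fun q : ℝ => q ^ 2) :
    (∀ a : ℝ, 0 < a → m ⟂ₘ QuasiBernoulli.hausdorffGauge (QuasiBernoulli.psi ℓ d a)) ∧
      ∀ a : ℝ, a < 0 → m ≪ QuasiBernoulli.packingGauge (QuasiBernoulli.psi ℓ d a) := by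
  have := hm.isProbabilityMeasure
  exact ⟨fun a ha => hI.mutuallySingular_hausdorffGauge hD hℓ hm hσ hτ ha.le,
    fun a ha => QuasiBernoulli.absolutelyContinuous_packingGauge
      (hI.ae_exists_measureReal_closedBall_le_psi hℓ hm hσ hτ ha.le)⟩
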